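/- For a complex number $q$ with $|q|<1$ let $$E_{2k}(q)=1-\frac{4k}{B_{2k}}\sum_{n\ge1}\sigma_{2k-1}(n)q^n,\qquad G_2(q)=2E_2(q^2)-E_2(q),$$ $$\theta_2(q)=\sum_{m\in\mathbb Z+\frac12}q^{m^2},\qquad \theta_3(q)=\sum_{m\in\mathbb Z}q^{m^2},\qquad \theta_4(q)=\sum_{m\in\mathbb Z}(-1)^mq^{m^2},$$ where $B_k$ are the Bernoulli numbers and $\sigma_k(n)=\sum_{d\mid n}d^k$, let $\Theta_{r,s}=\theta_2^{4r}\theta_3^{4s}+\theta_2^{4s}\theta_3^{4r}$, and let $D=q\frac{d}{dq}$. Define rational numbers $\widetilde c_c(\alpha,\beta,\gamma)$, for integers $\alpha,\beta,\gamma$, by $\widetilde c_c(\alpha,\beta,\gamma)=0$ if any argument is negative, $\widetilde c_c(0,0,0)=1$, and for all other $\alpha,\beta,\gamma\ge0$ $$\begin{aligned}\widetilde c_c(\alpha,\beta,\gamma)={}&\frac{2\alpha+4\beta+8\gamma-1}{24}\,\widetilde c_c(\alpha-1,\beta,\gamma)+\frac{24\gamma-8\beta+7}{24}\,\widetilde c_c(\alpha,\beta-1,\gamma)\\&-\frac{\alpha+1}{12}\,\widetilde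 c_c(\alpha+1,\beta,\gamma-1)+\frac{\beta+1}{6}\,\widetilde c_c(\alpha,\beta+1,\gamma-1)-\frac{4(\gamma+1)}{3}\,\widetilde c_c(\alpha,\beta-3,\gamma+1).\end{aligned}$$ Then for every positive integer $t$ and every $q$ with $|q|<1$ we have $G_2(q)=\Theta_{0,1}(q)$, $\theta_4(q)\neq0$, and $$\frac{D^t(\theta_4(q))}{\theta_4(q)}=\sum_{\substack{\alpha,\beta,\gamma\ge0\\ \alpha+\beta+2\gamma=t}}\widetilde c_c(\alpha,\beta,\gamma)\,E_2(q)^{\alpha}\,G_2(q)^{\beta}\,E_4(q)^{\gamma}.$$ -/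

import Mathlib

namespace QuasiTheta

noncomputable section

/-- The classical Eisenstein series `E_{2k}(q) = 1 - (4k / B_{2k}) ∑_{n ≥ 1} σ_{2k-1}(n) q^n`
(argument `k`, for `k ≥ 1`), as a function of the complex variable `q`, `|q| < 1`.
Thus `Eis 1` is `E_2` and `Eis 2` is `E_4`. -/
def Eis (k : ℕ) (q : ℂ) : ℂ :=
  1 - (4 * (k : ℂ) / ((bernoulli (2 * k) : ℚ) : ℂ)) *
    ∑' n : ℕ, ((ArithmeticFunction.sigma (2 * k - 1) (n + 1) : ℕ) : ℂ) * q ^ (n + 1)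

/-- `G_2(q) = 2 E_2(q²) - E_2(q)`. -/
def G2 (q : ℂ) : ℂ := 2 * Eis 1 (q ^ 2) - Eis 1 q

/-- `θ_2(q) = ∑_{m ∈ ℤ + 1/2} q^{m²}`, with the principal branch of the powers of `q`.
Only the fourth power of `θ_2` is used below, and it does not depend on the branch. -/
def theta2 (q : ℂ) : ℂ := ∑' m : ℤ, q ^ (((m : ℂ) + 1 / 2) ^ 2)

/-- `θ_3(q) = ∑_{m ∈ ℤ} q^{m²}`. -/
def theta3 (q : ℂ) : ℂ := ∑' m : ℤ, q ^ (m ^ 2).toNat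

/-- `θ_4(q) = ∑_{m ∈ ℤ} (-1)^m q^{m²}`. -/
def theta4 (q : ℂ) : ℂ := ∑' m : ℤ, (-1 : ℂ) ^ m * q ^ (m ^ 2).toNat

/-- `Θ_{r,s} = θ_2^{4r} θ_3^{4s} + θ_2^{4s} θ_3^{4r}`. -/
def Theta (r s : ℕ) (q : ℂ) : ℂ :=
  theta2 q ^ (4 * r) * theta3 q ^ (4 * s) + theta2 q ^ (4 * s) * theta3 q ^ (4 * r)

/-- The derivation `D = q d/dq`. -/
def D (f : ℂ → ℂ) : ℂ → ℂ := fun q => q * deriv f q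

/-- The rational numbers `c̃(α, β, γ)`: they vanish if an argument is negative,
`c̃(0, 0, 0) = 1`, and all other values are given by the five-term recursion. -/
def cTilde (α β γ : ℤ) : ℚ :=
  if α < 0 ∨ β < 0 ∨ γ < 0 then 0
  else if α = 0 ∧ β = 0 ∧ γ = 0 then 1
  else
    (2 * (α : ℚ) + 4 * β + 8 * γ - 1) / 24 * cTilde (α - 1) β γ
      + (24 * (γ : ℚ) - 8 * β + 7) / 24 * cTilde α (β - 1) γ
      - ((α : ℚ) + 1) / 12 * cTilde (α + 1) β (γ - 1)
      + ((β : ℚ) + 1) / 6 * cTilde α (β + 1) (γ - 1)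
      - 4 * ((γ : ℚ) + 1) / 3 * cTilde α (β - 3) (γ + 1)
termination_by (α + β + 2 * γ).toNat
decreasing_by all_goals omega

end

end QuasiTheta

namespace QuasiTheta

open Filter Topology

noncomputable section

/-! The polynomial ring in $E_2,G_2,E_4$ is closed under $D$ (`D_eis_one`, `D_G2`, `D_eis_two`), and
$D\theta_4=\theta_4(E_2-G_2)/24$ (`D_theta4`). Hence $D^t\theta_4=\theta_4P_t(E_2,G_2,E_4)$ with
$P_{t+1}=\frac{E_2-G_2}{24}P_t+DP_t$, and comparing coefficients of monomials gives the five-term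
recursion (`weightPoly_succ`, `D_iterate_theta4`).

The differential rules are obtained without modular forms. Formulas relating theta functions at $q$
and $q^2$ come from splitting lattice sums by parity. Gauss's product (`theta4_mul_eulerProd`) gives
$\theta_4\ne0$ and expresses $D\log\theta_4$ through $E_2$. Ramanujan's formula for $DE_2$ follows
from an elementary convolution identity (`lambert_sq`).

The remaining identities come from rigidity under $q\mapsto q^2$ (`eq_of_invariant_sq`,
`eq_zero_of_four_mul_sq`): a suitable quotient or difference satisfies $f(q)=f(q^2)$ or
$f(q)=4f(q^2)$, so its behaviour at $0$ determines it. This yields $D\log\theta_3-D\log\theta_4$,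
then $G_2=2\theta_3^4-\theta_4^4$, then $E_4$ as a polynomial in $\theta_3^4,\theta_4^4$.
Differentiating these expressions gives $DG_2$ and $DE_4$. -/

/-! ### Convergence of the theta series. -/

lemma summable_norm_of_natAbs_le {q : ℂ} (hq : ‖q‖ < 1) {e : ℤ → ℕ} {C : ℝ}
    (he : ∀ m : ℤ, m.natAbs ≤ e m + 1) (c : ℤ → ℂ) (hc : ∀ m, ‖c m‖ ≤ C) :
    Summable fun m : ℤ => ‖c m * q ^ e m‖ := by
  have hC : 0 ≤ C := (norm_nonneg _).trans (hc 0)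
  obtain ⟨r, hr1, hr2⟩ := exists_between hq
  have hr0 : 0 < r := (norm_nonneg _).trans_lt hr1
  have hs : Summable fun m : ℤ => r ^ m.natAbs := by
    apply Summable.of_nat_of_neg <;>
      simpa using summable_geometric_of_lt_one hr0.le hr2
  refine Summable.of_nonneg_of_le (fun _ => norm_nonneg _) (fun m => ?_) (hs.mul_left (C / r))
  rw [norm_mul, norm_pow]
  have h1 : ‖q‖ ^ e m ≤ r ^ e m := pow_le_pow_left₀ (norm_nonneg _) hr1.le _
  have h2 : r ^ (e m + 1) ≤ r ^ m.natAbs := pow_le_pow_of_le_one hr0.le hr2.le (he m)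
  have h3 : r ^ e m ≤ r ^ m.natAbs / r := by
    rw [le_div_iff₀ hr0, ← pow_succ]; exact h2
  calc ‖c m‖ * ‖q‖ ^ e m ≤ C * (r ^ m.natAbs / r) := by
        gcongr
        · exact hc m
        · exact h1.trans h3
    _ = C / r * r ^ m.natAbs := by ring

lemma natAbs_le_sq (m : ℤ) : m.natAbs ≤ (m ^ 2).toNat + 1 := by
  have h : (m.natAbs : ℤ) ≤ m ^ 2 := by
    rw [← Int.natAbs_sq, sq]
    exact_mod_cast Nat.le_mul_self _
  have := sq_nonneg m
  omega

lemma sq_add_self_nonneg (m : ℤ) : 0 ≤ m ^ 2 + m := by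
  rcases le_or_gt 0 m with h | h <;> nlinarith

/-- The slack $1$ is needed at $m=-1$, where $m^2+m=0$. -/
lemma natAbs_le_sq_add_self (m : ℤ) : m.natAbs ≤ (m ^ 2 + m).toNat + 1 := by
  have h : (m.natAbs : ℤ) ≤ m ^ 2 + m + 1 := by
    rcases abs_cases m with h | h <;> rw [Int.natCast_natAbs] <;> nlinarith
  have := sq_add_self_nonneg m
  omega

/-- The series `∑_{m ∈ ℤ} q^{m² + m}`, which is `q^{-1/4} θ_2(q)`. -/
def theta2Core (q : ℂ) : ℂ := ∑' m : ℤ, q ^ (m ^ 2 + m).toNat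

lemma summable_norm_theta3 {q : ℂ} (hq : ‖q‖ < 1) :
    Summable fun m : ℤ => ‖q ^ (m ^ 2).toNat‖ := by
  simpa using summable_norm_of_natAbs_le hq natAbs_le_sq (fun _ => 1) (C := 1) (by simp)

lemma summable_norm_theta4 {q : ℂ} (hq : ‖q‖ < 1) :
    Summable fun m : ℤ => ‖(-1 : ℂ) ^ m * q ^ (m ^ 2).toNat‖ :=
  summable_norm_of_natAbs_le hq natAbs_le_sq (fun m => (-1 : ℂ) ^ m) (C := 1) (by simp)

lemma summable_norm_theta2Core {q : ℂ} (hq : ‖q‖ < 1) :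
    Summable fun m : ℤ => ‖q ^ (m ^ 2 + m).toNat‖ := by
  simpa using summable_norm_of_natAbs_le hq natAbs_le_sq_add_self (fun _ => 1) (C := 1) (by simp)

lemma tsum_int_add (f : ℤ → ℂ) (a : ℤ) : ∑' m, f (m + a) = ∑' m, f m :=
  (Equiv.addRight a).tsum_eq f

lemma summable_int_add {E : Type*} [NormedAddCommGroup E] [CompleteSpace E] {f : ℤ → E}
    (hf : Summable f) (a : ℤ) : Summable fun m => f (m + a) :=
  hf.comp_injective (add_left_injective a)

lemma norm_sq_lt_one {q : ℂ} (hq : ‖q‖ < 1) : ‖q ^ 2‖ < 1 := by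
  rw [norm_pow]; exact pow_lt_one₀ (norm_nonneg _) hq two_ne_zero

/-! ### Theta identities relating $q$ and $q^2$, and Jacobi's quartic identity. -/

/-- Splitting of pairs of integers by the parity of their sum. -/
def parityMap : (ℤ × ℤ) ⊕ (ℤ × ℤ) → ℤ × ℤ :=
  Sum.elim (fun p => (p.1 + p.2, p.1 - p.2)) (fun p => (p.1 + p.2 + 1, p.1 - p.2))

lemma parityMap_bijective : Function.Bijective parityMap := by
  constructor
  · rintro (⟨a, b⟩ | ⟨a, b⟩) (⟨c, d⟩ | ⟨c, d⟩) h <;>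
      simp only [parityMap, Sum.elim_inl, Sum.elim_inr, Prod.mk.injEq] at h
    · simp only [Sum.inl.injEq, Prod.mk.injEq]; omega
    · omega
    · omega
    · simp only [Sum.inr.injEq, Prod.mk.injEq]; omega
  · rintro ⟨m, n⟩
    rcases Int.even_or_odd (m + n) with ⟨k, hk⟩ | ⟨k, hk⟩
    · refine ⟨Sum.inl (k, m - k), ?_⟩
      simp only [parityMap, Sum.elim_inl, Prod.mk.injEq]; omega
    · refine ⟨Sum.inr (k, m - 1 - k), ?_⟩
      simp only [parityMap, Sum.elim_inr, Prod.mk.injEq]; omega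

/-- The source of all the $q\mapsto q^2$ formulas: $(u+v)^2+(u-v)^2=2u^2+2v^2$ and
$(u+v+1)^2+(u-v)^2=2(u^2+u)+2(v^2+v)+1$. -/
lemma tsum_parity {f : ℤ × ℤ → ℂ} (hf : Summable f) :
    ∑' p, f p = (∑' p : ℤ × ℤ, f (p.1 + p.2, p.1 - p.2)) +
      ∑' p : ℤ × ℤ, f (p.1 + p.2 + 1, p.1 - p.2) := by
  let e := Equiv.ofBijective parityMap parityMap_bijective
  have hs : Summable (f ∘ e) := e.summable_iff.mpr hf
  rw [← e.tsum_eq]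
  exact Summable.tsum_sum (hs.comp_injective Sum.inl_injective)
    (hs.comp_injective Sum.inr_injective)

lemma pow_toNat_mul {q : ℂ} {a b c : ℤ} (ha : 0 ≤ a) (hb : 0 ≤ b) (h : a + b = c) :
    q ^ a.toNat * q ^ b.toNat = q ^ c.toNat := by
  rw [← pow_add]; congr 1; omega

lemma sq_pow_toNat {q : ℂ} {a c : ℤ} (ha : 0 ≤ a) (h : 2 * a = c) :
    (q ^ 2) ^ a.toNat = q ^ c.toNat := by
  rw [← pow_mul]; congr 1; omega

lemma neg_one_zpow_sq (m : ℤ) : ((-1 : ℂ) ^ m) * (-1) ^ m = 1 := by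
  rw [← zpow_add₀ (by norm_num), ← two_mul, zpow_mul]; norm_num

lemma theta3_mul_self {q : ℂ} (hq : ‖q‖ < 1) :
    theta3 q ^ 2 = theta3 (q ^ 2) ^ 2 + q * theta2Core (q ^ 2) ^ 2 := by
  have hs := summable_norm_theta3 hq
  have hs2 := summable_norm_theta3 (norm_sq_lt_one hq)
  have hc2 := summable_norm_theta2Core (norm_sq_lt_one hq)
  rw [sq, sq, sq (theta2Core _), theta3, theta3, theta2Core,
    tsum_mul_tsum_of_summable_norm hs hs, tsum_mul_tsum_of_summable_norm hs2 hs2,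
    tsum_mul_tsum_of_summable_norm hc2 hc2, ← tsum_mul_left,
    tsum_parity (summable_mul_of_summable_norm hs hs)]
  congr 1 <;> refine tsum_congr fun ⟨u, v⟩ => ?_
  · dsimp only
    rw [sq_pow_toNat (sq_nonneg u) rfl, sq_pow_toNat (sq_nonneg v) rfl,
      pow_toNat_mul (by positivity) (by positivity) rfl,
      pow_toNat_mul (by positivity) (by positivity) rfl]
    congr 2; ring
  · have h1 := sq_add_self_nonneg u
    have h2 := sq_add_self_nonneg v
    dsimp only
    rw [sq_pow_toNat h1 rfl, sq_pow_toNat h2 rfl,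
      pow_toNat_mul (by positivity) (by positivity) rfl,
      pow_toNat_mul (by positivity) (by positivity) rfl, ← pow_succ']
    congr 1
    zify
    rw [Int.toNat_of_nonneg (by positivity), Int.toNat_of_nonneg (by positivity)]
    ring

lemma theta4_mul_self {q : ℂ} (hq : ‖q‖ < 1) :
    theta4 q ^ 2 = theta3 (q ^ 2) ^ 2 - q * theta2Core (q ^ 2) ^ 2 := by
  have hs := summable_norm_theta4 hq
  have hs2 := summable_norm_theta3 (norm_sq_lt_one hq)
  have hc2 := summable_norm_theta2Core (norm_sq_lt_one hq)
  rw [sq, sq, sq (theta2Core _), theta4, theta3, theta2Core,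
    tsum_mul_tsum_of_summable_norm hs hs, tsum_mul_tsum_of_summable_norm hs2 hs2,
    tsum_mul_tsum_of_summable_norm hc2 hc2, ← tsum_mul_left,
    tsum_parity (summable_mul_of_summable_norm hs hs), sub_eq_add_neg, ← tsum_neg]
  have h10 : (-1 : ℂ) ≠ 0 := by norm_num
  congr 1 <;> refine tsum_congr fun ⟨u, v⟩ => ?_
  · dsimp only
    rw [mul_mul_mul_comm, ← zpow_add₀ h10, show u + v + (u - v) = u + u by ring, zpow_add₀ h10,
      neg_one_zpow_sq, one_mul, sq_pow_toNat (sq_nonneg u) rfl, sq_pow_toNat (sq_nonneg v) rfl,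
      pow_toNat_mul (by positivity) (by positivity) rfl,
      pow_toNat_mul (by positivity) (by positivity) rfl]
    congr 2; ring
  · have h1 := sq_add_self_nonneg u
    have h2 := sq_add_self_nonneg v
    dsimp only
    rw [mul_mul_mul_comm, ← zpow_add₀ h10, show u + v + 1 + (u - v) = u + u + 1 by ring,
      zpow_add₀ h10, zpow_add₀ h10, neg_one_zpow_sq, one_mul, zpow_one, neg_one_mul, neg_inj,
      sq_pow_toNat h1 rfl, sq_pow_toNat h2 rfl,
      pow_toNat_mul (by positivity) (by positivity) rfl,
      pow_toNat_mul (by positivity) (by positivity) rfl, ← pow_succ']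
    congr 1
    zify
    rw [Int.toNat_of_nonneg (by positivity), Int.toNat_of_nonneg (by positivity)]
    ring

lemma theta2Core_mul_self {q : ℂ} (hq : ‖q‖ < 1) :
    theta2Core q ^ 2 = 2 * (theta2Core (q ^ 2) * theta3 (q ^ 2)) := by
  have hs := summable_norm_theta2Core hq
  have hs2 := summable_norm_theta3 (norm_sq_lt_one hq)
  have hc2 := summable_norm_theta2Core (norm_sq_lt_one hq)
  -- The odd class has exponent $2(u+1)^2+2(v^2+v)$, so one copy of $\theta_3$ is written with its
  -- index shifted by one.
  have hshift := tsum_int_add (fun m : ℤ => (q ^ 2) ^ (m ^ 2).toNat) 1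
  have hs3 := summable_int_add hs2 1
  rw [← theta3] at hshift
  rw [two_mul, sq]
  nth_rw 3 [mul_comm]
  nth_rw 2 [← hshift]
  rw [theta2Core, theta3, theta2Core,
    tsum_mul_tsum_of_summable_norm hs hs, tsum_mul_tsum_of_summable_norm hs3 hc2,
    tsum_mul_tsum_of_summable_norm hc2 hs2,
    tsum_parity (summable_mul_of_summable_norm hs hs)]
  congr 1 <;> refine tsum_congr fun ⟨u, v⟩ => ?_
  · have h1 := sq_add_self_nonneg u
    dsimp only
    rw [sq_pow_toNat h1 rfl, sq_pow_toNat (sq_nonneg v) rfl,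
      pow_toNat_mul (sq_add_self_nonneg _) (sq_add_self_nonneg _) rfl,
      pow_toNat_mul (by positivity) (by positivity) rfl]
    congr 2; ring
  · have h1 := sq_add_self_nonneg v
    dsimp only
    rw [sq_pow_toNat h1 rfl, sq_pow_toNat (sq_nonneg (u + 1)) rfl,
      pow_toNat_mul (sq_add_self_nonneg _) (sq_add_self_nonneg _) rfl,
      pow_toNat_mul (by positivity) (by positivity) rfl]
    congr 2; ring

/-- `∑_{m ∈ ℤ} (-1)^m q^{m² + m} = 0`. -/
lemma tsum_neg_one_zpow_mul_sq_add_self (q : ℂ) :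
    ∑' m : ℤ, (-1 : ℂ) ^ m * q ^ (m ^ 2 + m).toNat = 0 := by
  have h : ∑' m : ℤ, (-1 : ℂ) ^ m * q ^ (m ^ 2 + m).toNat =
      -∑' m : ℤ, (-1 : ℂ) ^ m * q ^ (m ^ 2 + m).toNat := by
    -- The involution $m\mapsto-1-m$ fixes $m^2+m$ and reverses the parity of $m$.
    conv_lhs => rw [← (Equiv.subLeft (-1 : ℤ)).tsum_eq]
    rw [← tsum_neg]
    refine tsum_congr fun m => ?_
    simp only [Equiv.subLeft_apply]
    rw [show (-1 - m) ^ 2 + (-1 - m) = m ^ 2 + m by ring, zpow_sub₀ (by norm_num),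
      div_eq_mul_inv, ← inv_zpow]
    norm_num
  exact self_eq_neg.mp h

lemma theta3_mul_theta4 {q : ℂ} (hq : ‖q‖ < 1) :
    theta3 q * theta4 q = theta4 (q ^ 2) ^ 2 := by
  have hs := summable_norm_theta3 hq
  have hs' := summable_norm_theta4 hq
  have hs2 := summable_norm_theta4 (norm_sq_lt_one hq)
  have hc2 := summable_norm_of_natAbs_le (norm_sq_lt_one hq) natAbs_le_sq_add_self
    (fun m => (-1 : ℂ) ^ m) (C := 1) (by simp)
  -- The added zero is the contribution of the odd class, a product of two series that cancel under
  -- $m\mapsto-1-m$.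
  have h0 : theta4 (q ^ 2) ^ 2 = theta4 (q ^ 2) ^ 2 +
      q * ((∑' m : ℤ, (-1 : ℂ) ^ m * (q ^ 2) ^ (m ^ 2 + m).toNat) *
        ∑' m : ℤ, (-1 : ℂ) ^ m * (q ^ 2) ^ (m ^ 2 + m).toNat) := by
    rw [tsum_neg_one_zpow_mul_sq_add_self]; simp
  rw [h0, sq, theta3, theta4, theta4,
    tsum_mul_tsum_of_summable_norm hs hs', tsum_mul_tsum_of_summable_norm hs2 hs2,
    tsum_mul_tsum_of_summable_norm hc2 hc2, ← tsum_mul_left,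
    tsum_parity (summable_mul_of_summable_norm hs hs')]
  have h10 : (-1 : ℂ) ≠ 0 := by norm_num
  have hsub : ∀ u v : ℤ, (-1 : ℂ) ^ (u - v) = (-1) ^ u * (-1) ^ v := fun u v => by
    rw [zpow_sub₀ h10, div_eq_mul_inv, ← inv_zpow]; norm_num
  congr 1 <;> refine tsum_congr fun ⟨u, v⟩ => ?_
  · dsimp only
    rw [mul_mul_mul_comm, mul_left_comm, hsub,
      sq_pow_toNat (sq_nonneg u) rfl, sq_pow_toNat (sq_nonneg v) rfl,
      pow_toNat_mul (by positivity) (by positivity) rfl,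
      pow_toNat_mul (by positivity) (by positivity) rfl]
    congr 3; ring
  · have h1 := sq_add_self_nonneg u
    have h2 := sq_add_self_nonneg v
    dsimp only
    rw [mul_mul_mul_comm, mul_left_comm (q ^ _), mul_left_comm q, hsub,
      sq_pow_toNat h1 rfl, sq_pow_toNat h2 rfl,
      pow_toNat_mul (by positivity) (by positivity) rfl,
      pow_toNat_mul (by positivity) (by positivity) rfl, ← pow_succ']
    congr 2
    zify
    rw [Int.toNat_of_nonneg (by positivity), Int.toNat_of_nonneg (by positivity)]
    ring

lemma theta3_sq_add_theta4_sq {q : ℂ} (hq : ‖q‖ < 1) :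
    theta3 q ^ 2 + theta4 q ^ 2 = 2 * theta3 (q ^ 2) ^ 2 := by
  rw [theta3_mul_self hq, theta4_mul_self hq]; ring

/-- The branch-free form of Jacobi's identity: $\theta_3^2\mp\theta_4^2$ are read off from the
formulas at $q^2$, and their product is $q$ times the square of `theta2Core_mul_self`. -/
lemma mul_theta2Core_pow_four {q : ℂ} (hq : ‖q‖ < 1) :
    q * theta2Core q ^ 4 = theta3 q ^ 4 - theta4 q ^ 4 := by
  have h1 := theta3_mul_self hq
  have h2 := theta4_mul_self hq
  have h3 := theta2Core_mul_self hq
  linear_combination q * (theta2Core q ^ 2 + 2 * (theta2Core (q ^ 2) * theta3 (q ^ 2))) * h3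
    - (theta3 q ^ 2 + (theta3 (q ^ 2) ^ 2 + q * theta2Core (q ^ 2) ^ 2)) * h1
    + (theta4 q ^ 2 + (theta3 (q ^ 2) ^ 2 - q * theta2Core (q ^ 2) ^ 2)) * h2

/-- Jacobi's quartic identity `θ_2^4 = θ_3^4 - θ_4^4`. -/
lemma theta2_pow_four {q : ℂ} (hq : ‖q‖ < 1) :
    theta2 q ^ 4 = theta3 q ^ 4 - theta4 q ^ 4 := by
  rw [← mul_theta2Core_pow_four hq]
  rcases eq_or_ne q 0 with rfl | hq0
  · have : theta2 0 = 0 := by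
      refine (tsum_congr (g := fun _ => (0 : ℂ)) fun m => ?_).trans tsum_zero
      rw [Complex.zero_cpow]
      refine pow_ne_zero _ fun h => ?_
      have h' : ((2 * m + 1 : ℤ) : ℂ) = 0 := by push_cast; linear_combination 2 * h
      have := Int.cast_eq_zero.mp h'
      omega
    simp [this]
  · have : theta2 q = q ^ (1 / 4 : ℂ) * theta2Core q := by
      rw [theta2, theta2Core, ← tsum_mul_left]
      refine tsum_congr fun m => ?_
      rw [← Complex.cpow_natCast q (m ^ 2 + m).toNat, ← Complex.cpow_add _ _ hq0]
      congr 1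
      have h : (((m ^ 2 + m).toNat : ℤ) : ℂ) = ((m ^ 2 + m : ℤ) : ℂ) := by
        rw [Int.toNat_of_nonneg (sq_add_self_nonneg m)]
      rw [Int.cast_natCast] at h
      rw [h]; push_cast; ring
    rw [this, mul_pow, ← Complex.cpow_nat_mul]
    norm_num

/-- The integers $m$ and $m^2$ have the same parity. -/
lemma theta4_eq_theta3_neg (q : ℂ) : theta4 q = theta3 (-q) := by
  refine tsum_congr fun m => ?_
  rw [neg_pow]
  congr 1
  have h : ((m ^ 2).toNat : ℤ) = m ^ 2 := Int.toNat_of_nonneg (sq_nonneg m)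
  rw [← zpow_natCast, h]
  rcases Int.even_or_odd m with hm | hm
  · rw [hm.neg_one_zpow, (hm.pow_of_ne_zero two_ne_zero).neg_one_zpow]
  · rw [hm.neg_one_zpow, hm.pow.neg_one_zpow]

lemma theta3_eq_theta4_neg (q : ℂ) : theta3 q = theta4 (-q) := by
  rw [theta4_eq_theta3_neg, neg_neg]

lemma differentiableOn_theta3 : DifferentiableOn ℂ theta3 (Metric.ball 0 1) := by
  intro q hq
  rw [mem_ball_zero_iff] at hq
  obtain ⟨r, hr1, hr2⟩ := exists_between hq
  have hr : ‖(r : ℂ)‖ = r := by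
    rw [Complex.norm_real, Real.norm_of_nonneg ((norm_nonneg _).trans hr1.le)]
  have hd : DifferentiableOn ℂ theta3 (Metric.ball 0 r) :=
    Complex.differentiableOn_tsum_of_summable_norm (summable_norm_theta3 (q := r) (by rwa [hr]))
      (fun i => by fun_prop) Metric.isOpen_ball fun i w hw => by
        rw [mem_ball_zero_iff] at hw
        rw [norm_pow, norm_pow, hr]
        exact pow_le_pow_left₀ (norm_nonneg _) hw.le _
  exact (hd.differentiableAt (Metric.isOpen_ball.mem_nhds
    (mem_ball_zero_iff.mpr hr1))).differentiableWithinAt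

/-! ### Gauss's product formula through the finite Jacobi triple product. -/

/-- The finite product `∏_{i=1}^{n} (1 - q^i)`. -/
def qPoch (q : ℂ) (n : ℕ) : ℂ := ∏ i ∈ Finset.range n, (1 - q ^ (i + 1))

/-- The Euler product `∏_{n ≥ 1} (1 - q^n)`. -/
def eulerProd (q : ℂ) : ℂ := ∏' n : ℕ, (1 - q ^ (n + 1))

/-- `1 / ∏_{i=1}^{m} (1 - q^i)`, extended by zero to negative `m`. -/
def invQPoch (q : ℂ) (m : ℤ) : ℂ := if m < 0 then 0 else (qPoch q m.toNat)⁻¹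

lemma one_sub_pow_ne_zero {q : ℂ} (hq : ‖q‖ < 1) (n : ℕ) : 1 - q ^ (n + 1) ≠ 0 := by
  intro h
  have h1 : ‖q ^ (n + 1)‖ < 1 := by
    rw [norm_pow]; exact pow_lt_one₀ (norm_nonneg _) hq n.succ_ne_zero
  rw [← sub_eq_zero.mp h] at h1
  simp at h1

lemma qPoch_ne_zero {q : ℂ} (hq : ‖q‖ < 1) (n : ℕ) : qPoch q n ≠ 0 :=
  Finset.prod_ne_zero_iff.mpr fun i _ => one_sub_pow_ne_zero hq i

lemma qPoch_succ (q : ℂ) (n : ℕ) : qPoch q (n + 1) = qPoch q n * (1 - q ^ (n + 1)) :=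
  Finset.prod_range_succ _ _

lemma tendsto_qPoch {q : ℂ} (hq : ‖q‖ < 1) :
    Tendsto (qPoch q) atTop (𝓝 (eulerProd q)) :=
  (ModularForm.multipliable_one_sub_pow hq).tendsto_prod_tprod_nat

lemma eulerProd_ne_zero {q : ℂ} (hq : ‖q‖ < 1) : eulerProd q ≠ 0 := by
  have hs : Summable fun n : ℕ => ‖-q ^ (n + 1)‖ := by
    simpa using (summable_nat_add_iff 1).mpr (summable_geometric_of_lt_one (norm_nonneg _) hq)
  have := tprod_one_add_ne_zero_of_summable (f := fun n : ℕ => -q ^ (n + 1))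
    (fun n => by simpa [sub_eq_add_neg] using one_sub_pow_ne_zero hq n) hs
  simpa [eulerProd, sub_eq_add_neg] using this

/-- At $m=0$ the factor $1-q^0$ vanishes, in agreement with the extension by zero. The rule
therefore holds at every integer and later computations have no boundary cases. -/
lemma invQPoch_sub_one {q : ℂ} (hq : ‖q‖ < 1) (m : ℤ) :
    invQPoch q (m - 1) = (1 - q ^ m) * invQPoch q m := by
  rcases lt_trichotomy m 0 with h | rfl | h
  · simp [invQPoch, h, show m - 1 < 0 by omega]
  · simp [invQPoch]
  · obtain ⟨n, rfl⟩ : ∃ n : ℕ, m = n + 1 := ⟨(m - 1).toNat, by omega⟩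
    have h1 := qPoch_ne_zero hq n
    have h2 := one_sub_pow_ne_zero hq n
    have h3 : ((n : ℤ) + 1).toNat = n + 1 := by omega
    have h4 : q ^ ((n : ℤ) + 1) = q ^ (n + 1) := by exact_mod_cast zpow_natCast q (n + 1)
    simp only [invQPoch, add_sub_cancel_right, h3, qPoch_succ, h4, Int.toNat_natCast]
    rw [if_neg (by omega), if_neg (by omega)]
    field_simp

/-- The coefficients `q^{k²} [2n; n+k]_{q²}` of the finite Jacobi triple product. -/
def tripleCoeff (q : ℂ) (n : ℕ) (k : ℤ) : ℂ :=
  q ^ (k ^ 2) * (qPoch (q ^ 2) (2 * n) * (invQPoch (q ^ 2) (n + k) * invQPoch (q ^ 2) (n - k)))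

/-- This is multiplication by $(1+zq^{2n+1})(1+z^{-1}q^{2n+1})=1+q^{4n+2}+q^{2n+1}(z+z^{-1})$, read
on the coefficient of $z^k$. -/
lemma tripleCoeff_succ {q : ℂ} (hq : ‖q‖ < 1) (hq0 : q ≠ 0) (n : ℕ) (k : ℤ) :
    tripleCoeff q (n + 1) k = (1 + q ^ (4 * n + 2)) * tripleCoeff q n k +
      q ^ (2 * n + 1) * (tripleCoeff q n (k - 1) + tripleCoeff q n (k + 1)) := by
  have hQ := norm_sq_lt_one hq
  have hQ0 : q ^ 2 ≠ 0 := pow_ne_zero _ hq0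
  have e1 := invQPoch_sub_one hQ (n + 1 + k)
  have e2 := invQPoch_sub_one hQ (n + k)
  have e3 := invQPoch_sub_one hQ (n + 1 - k)
  have e4 := invQPoch_sub_one hQ (n - k)
  rw [show (n : ℤ) + 1 + k - 1 = n + k by ring] at e1
  rw [show (n : ℤ) + 1 - k - 1 = n - k by ring] at e3
  simp only [tripleCoeff]
  rw [show 2 * (n + 1) = 2 * n + 1 + 1 by ring, qPoch_succ, qPoch_succ]
  rw [show ((n + 1 : ℕ) : ℤ) + k = n + 1 + k by push_cast; ring,
    show ((n + 1 : ℕ) : ℤ) - k = n + 1 - k by push_cast; ring,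
    show (n : ℤ) + (k - 1) = n + k - 1 by ring, show (n : ℤ) - (k - 1) = n + 1 - k by ring,
    show (n : ℤ) + (k + 1) = n + 1 + k by ring, show (n : ℤ) - (k + 1) = n - k - 1 by ring,
    e2, e4, e1, e3]
  -- Every inverse product is now a multiple of these two; what is left is a rational identity in
  -- $q$, $q^n$ and $q^k$.
  generalize invQPoch (q ^ 2) (n + 1 + k) = x
  generalize invQPoch (q ^ 2) (n + 1 - k) = y
  generalize qPoch (q ^ 2) (2 * n) = P
  have z1 : q ^ ((k - 1) ^ 2) = q ^ (k ^ 2) * q / (q ^ k) ^ 2 := by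
    rw [show (k - 1) ^ 2 = k ^ 2 + 1 - k * 2 by ring, zpow_sub₀ hq0, zpow_add₀ hq0, zpow_one,
      zpow_mul]; norm_cast
  have z2 : q ^ ((k + 1) ^ 2) = q ^ (k ^ 2) * q * (q ^ k) ^ 2 := by
    rw [show (k + 1) ^ 2 = k ^ 2 + 1 + k * 2 by ring, zpow_add₀ hq0, zpow_add₀ hq0, zpow_one,
      zpow_mul]; norm_cast
  have w1 : (q ^ 2) ^ ((n : ℤ) + 1 + k) = (q ^ n) ^ 2 * q ^ 2 * (q ^ k) ^ 2 := by
    rw [zpow_add₀ hQ0, zpow_add₀ hQ0, zpow_one, zpow_natCast, ← pow_mul, ← pow_mul, mul_comm 2 n]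
    congr 1
    rw [← zpow_natCast, ← zpow_natCast, ← zpow_mul, ← zpow_mul, mul_comm]
  have w2 : (q ^ 2) ^ ((n : ℤ) + k) = (q ^ n) ^ 2 * (q ^ k) ^ 2 := by
    rw [zpow_add₀ hQ0, zpow_natCast, ← pow_mul, ← pow_mul, mul_comm 2 n]
    congr 1
    rw [← zpow_natCast, ← zpow_natCast, ← zpow_mul, ← zpow_mul, mul_comm]
  have w3 : (q ^ 2) ^ ((n : ℤ) + 1 - k) = (q ^ n) ^ 2 * q ^ 2 / (q ^ k) ^ 2 := by
    rw [zpow_sub₀ hQ0, zpow_add₀ hQ0, zpow_one, zpow_natCast, ← pow_mul, ← pow_mul, mul_comm 2 n]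
    congr 1
    rw [← zpow_natCast, ← zpow_natCast, ← zpow_mul, ← zpow_mul, mul_comm]
  have w4 : (q ^ 2) ^ ((n : ℤ) - k) = (q ^ n) ^ 2 / (q ^ k) ^ 2 := by
    rw [zpow_sub₀ hQ0, zpow_natCast, ← pow_mul, ← pow_mul, mul_comm 2 n]
    congr 1
    rw [← zpow_natCast, ← zpow_natCast, ← zpow_mul, ← zpow_mul, mul_comm]
  have v1 : (q ^ 2) ^ (2 * n + 1) = (q ^ n) ^ 4 * q ^ 2 := by ring
  have v2 : (q ^ 2) ^ (2 * n + 1 + 1) = (q ^ n) ^ 4 * q ^ 4 := by ring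
  have v3 : q ^ (4 * n + 2) = (q ^ n) ^ 4 * q ^ 2 := by ring
  have v4 : q ^ (2 * n + 1) = (q ^ n) ^ 2 * q := by ring
  rw [z1, z2, w1, w2, w3, w4, v1, v2, v3, v4]
  have hk0 : q ^ k ≠ 0 := zpow_ne_zero _ hq0
  generalize q ^ (k ^ 2) = R
  generalize q ^ k = K at *
  generalize q ^ n = N
  field_simp
  ring

lemma tripleCoeff_support (q : ℂ) (n : ℕ) :
    (Function.support (tripleCoeff q n)).Finite := by
  refine (Set.finite_Icc (-(n : ℤ)) n).subset fun k hk => ?_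
  by_contra h
  refine hk ?_
  rw [Set.mem_Icc, not_and_or] at h
  rcases h with h | h
  · simp [tripleCoeff, invQPoch, show (n : ℤ) + k < 0 by omega]
  · simp [tripleCoeff, invQPoch, show (n : ℤ) - k < 0 by omega]

lemma summable_tripleCoeff (q : ℂ) (n : ℕ) :
    Summable fun k : ℤ => (-1 : ℂ) ^ k * tripleCoeff q n k :=
  summable_of_hasFiniteSupport <| (tripleCoeff_support q n).subset fun k hk h0 => hk <| by
    simp only [h0, mul_zero]

/-- The finite Jacobi triple product at `z = -1`. -/
lemma tsum_tripleCoeff {q : ℂ} (hq : ‖q‖ < 1) (hq0 : q ≠ 0) (n : ℕ) :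
    ∑' k : ℤ, (-1 : ℂ) ^ k * tripleCoeff q n k =
      (∏ i ∈ Finset.range n, (1 - q ^ (2 * i + 1))) ^ 2 := by
  induction n with
  | zero =>
    rw [tsum_eq_single 0]
    · simp [tripleCoeff, invQPoch, qPoch]
    · intro k hk
      rcases lt_or_gt_of_ne hk with h | h
      · simp [tripleCoeff, invQPoch, h]
      · simp [tripleCoeff, invQPoch, h]
  | succ n ih =>
    have hs := summable_tripleCoeff q n
    have h10 : (-1 : ℂ) ≠ 0 := by norm_num
    have s1 := summable_int_add hs (-1)
    have s2 := summable_int_add hs 1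
    have t1 := tsum_int_add (fun k : ℤ => (-1 : ℂ) ^ k * tripleCoeff q n k) (-1)
    have t2 := tsum_int_add (fun k : ℤ => (-1 : ℂ) ^ k * tripleCoeff q n k) 1
    simp only [← sub_eq_add_neg] at s1 t1
    have key : ∀ k : ℤ, (-1 : ℂ) ^ k * tripleCoeff q (n + 1) k =
        (1 + q ^ (4 * n + 2)) * ((-1 : ℂ) ^ k * tripleCoeff q n k) +
        -q ^ (2 * n + 1) * ((-1 : ℂ) ^ (k - 1) * tripleCoeff q n (k - 1) +
          (-1 : ℂ) ^ (k + 1) * tripleCoeff q n (k + 1)) := fun k => by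
      rw [tripleCoeff_succ hq hq0, zpow_sub_one₀ h10, zpow_add_one₀ h10]
      norm_num
      ring
    rw [tsum_congr key, (hs.mul_left _).tsum_add ((s1.add s2).mul_left _), tsum_mul_left,
      tsum_mul_left, s1.tsum_add s2, t1, t2, ih, Finset.prod_range_succ]
    ring

/-- The odd factors are all of the first $2n$ factors divided by the even ones. -/
lemma tendsto_prod_odd {q : ℂ} (hq : ‖q‖ < 1) :
    Tendsto (fun n => ∏ i ∈ Finset.range n, (1 - q ^ (2 * i + 1))) atTop
      (𝓝 (eulerProd q / eulerProd (q ^ 2))) := by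
  have h : ∀ n, ∏ i ∈ Finset.range n, (1 - q ^ (2 * i + 1)) =
      qPoch q (2 * n) / qPoch (q ^ 2) n := fun n => by
    rw [eq_div_iff (qPoch_ne_zero (norm_sq_lt_one hq) n)]
    induction n with
    | zero => simp [qPoch]
    | succ n ih =>
      rw [show 2 * (n + 1) = 2 * n + 1 + 1 by ring, qPoch_succ, qPoch_succ, qPoch_succ, ← ih,
        Finset.prod_range_succ]
      ring
  simp_rw [h]
  exact ((tendsto_qPoch hq).comp (tendsto_id.const_mul_atTop' two_pos)).div
    (tendsto_qPoch (norm_sq_lt_one hq)) (eulerProd_ne_zero (norm_sq_lt_one hq))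

lemma tendsto_invQPoch {q : ℂ} (hq : ‖q‖ < 1) :
    Tendsto (invQPoch q) atTop (𝓝 (eulerProd q)⁻¹) := by
  have h : Tendsto (fun m : ℤ => (qPoch q m.toNat)⁻¹) atTop (𝓝 (eulerProd q)⁻¹) :=
    ((tendsto_qPoch hq).inv₀ (eulerProd_ne_zero hq)).comp
      (tendsto_atTop_atTop.mpr fun b => ⟨b, fun a ha => by omega⟩)
  refine h.congr' ?_
  filter_upwards [eventually_ge_atTop 0] with m hm
  simp [invQPoch, not_lt.mpr hm]

lemma exists_norm_qPoch_le {q : ℂ} (hq : ‖q‖ < 1) : ∃ C, ∀ n, ‖qPoch q n‖ ≤ C := by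
  obtain ⟨C, hC⟩ := (tendsto_qPoch hq).norm.bddAbove_range
  exact ⟨C, fun n => hC ⟨n, rfl⟩⟩

lemma exists_norm_invQPoch_le {q : ℂ} (hq : ‖q‖ < 1) : ∃ C, ∀ m, ‖invQPoch q m‖ ≤ C := by
  obtain ⟨C, hC⟩ := ((tendsto_qPoch hq).inv₀ (eulerProd_ne_zero hq)).norm.bddAbove_range
  refine ⟨C, fun m => ?_⟩
  have h : ∀ n, ‖(qPoch q n)⁻¹‖ ≤ C := fun n => hC ⟨n, rfl⟩
  unfold invQPoch
  split_ifs
  · simpa using (norm_nonneg _).trans (h 0)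
  · exact h _

/-- Gauss's product formula for `θ_4`. -/
lemma theta4_mul_eulerProd {q : ℂ} (hq : ‖q‖ < 1) :
    theta4 q * eulerProd (q ^ 2) = eulerProd q ^ 2 := by
  -- The coefficient recursion divides by powers of $q$, so $q=0$ is treated apart.
  rcases eq_or_ne q 0 with rfl | hq0
  · have : theta4 0 = 1 := by
      rw [theta4, tsum_eq_single 0]
      · simp
      · intro m hm
        have : 0 < m ^ 2 := by positivity
        rw [zero_pow (by omega), mul_zero]
    simp [this, eulerProd]
  have hQ := norm_sq_lt_one hq
  have hE := eulerProd_ne_zero hQ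
  obtain ⟨C, hC⟩ := exists_norm_qPoch_le hQ
  obtain ⟨K, hK⟩ := exists_norm_invQPoch_le hQ
  have hC0 : 0 ≤ C := (norm_nonneg _).trans (hC 0)
  have hK0 : 0 ≤ K := (norm_nonneg _).trans (hK 0)
  have hsq : ∀ k : ℤ, q ^ (k ^ 2) = q ^ (k ^ 2).toNat := fun k => by
    rw [← zpow_natCast, Int.toNat_of_nonneg (sq_nonneg k)]
  -- Dominated convergence as $n\to\infty$: of the three Pochhammer factors, each tending to a power
  -- $\pm1$ of the Euler product at $q^2$, one inverse survives. The bounds `C`, `K` on them give a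
  -- majorant proportional to $|q|^{k^2}$.
  have hlim : Tendsto (fun n => ∑' k : ℤ, (-1 : ℂ) ^ k * tripleCoeff q n k) atTop
      (𝓝 (∑' k : ℤ, (-1 : ℂ) ^ k * q ^ (k ^ 2).toNat * (eulerProd (q ^ 2))⁻¹)) := by
    refine tendsto_tsum_of_dominated_convergence
      ((summable_norm_theta3 hq).mul_right (C * (K * K))) (fun k => ?_)
      (Eventually.of_forall fun n k => ?_)
    · have a1 : Tendsto (fun n : ℕ => qPoch (q ^ 2) (2 * n)) atTop (𝓝 (eulerProd (q ^ 2))) :=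
        (tendsto_qPoch hQ).comp (tendsto_id.const_mul_atTop' two_pos)
      have a2 : Tendsto (fun n : ℕ => invQPoch (q ^ 2) (n + k)) atTop
          (𝓝 (eulerProd (q ^ 2))⁻¹) :=
        (tendsto_invQPoch hQ).comp
          (tendsto_atTop_add_const_right _ _ tendsto_natCast_atTop_atTop)
      have a3 : Tendsto (fun n : ℕ => invQPoch (q ^ 2) (n - k)) atTop
          (𝓝 (eulerProd (q ^ 2))⁻¹) :=
        (tendsto_invQPoch hQ).comp
          (tendsto_atTop_add_const_right _ (-k) tendsto_natCast_atTop_atTop)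
      have := ((a1.mul (a2.mul a3)).const_mul (q ^ (k ^ 2))).const_mul ((-1 : ℂ) ^ k)
      rw [mul_inv_cancel_left₀ hE, hsq, ← mul_assoc] at this
      simpa only [tripleCoeff, hsq] using this
    · rw [norm_mul, norm_zpow, norm_neg, norm_one, one_zpow, one_mul, tripleCoeff, hsq, norm_mul,
        norm_mul, norm_mul]
      gcongr
      · exact hC _
      · exact hK _
      · exact hK _
  rw [tsum_mul_right] at hlim
  simp_rw [tsum_tripleCoeff hq hq0] at hlim
  have := tendsto_nhds_unique hlim ((tendsto_prod_odd hq).pow 2)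
  rw [← theta4] at this
  field_simp at this
  exact this

lemma theta4_ne_zero {q : ℂ} (hq : ‖q‖ < 1) : theta4 q ≠ 0 := fun h =>
  pow_ne_zero 2 (eulerProd_ne_zero hq) (by rw [← theta4_mul_eulerProd hq, h, zero_mul])

lemma theta3_ne_zero {q : ℂ} (hq : ‖q‖ < 1) : theta3 q ≠ 0 := by
  rw [theta3_eq_theta4_neg]
  exact theta4_ne_zero (by rwa [norm_neg])

/-! ### Lambert series and their derivatives. -/

/-- The double Lambert series `∑_{a, x ≥ 1} a^j x^k q^{ax}`. -/
def lambert (j k : ℕ) (q : ℂ) : ℂ :=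
  ∑' p : ℕ+ × ℕ+, (p.1 : ℂ) ^ j * (p.2 : ℂ) ^ k * q ^ (p.1 * p.2 : ℕ)

lemma summable_norm_lambert {q : ℂ} (hq : ‖q‖ < 1) (j k : ℕ) :
    Summable fun p : ℕ+ × ℕ+ => ‖(p.1 : ℂ) ^ j * (p.2 : ℂ) ^ k * q ^ (p.1 * p.2 : ℕ)‖ := by
  obtain ⟨r, hr1, hr2⟩ := exists_between hq
  have hr0 : 0 ≤ r := (norm_nonneg _).trans hr1.le
  have hrn : ‖r‖ < 1 := by rwa [Real.norm_of_nonneg hr0]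
  have hrpos : 0 < r := (norm_nonneg _).trans_lt hr1
  have hx : ‖‖q‖ / r‖ < 1 := by
    rw [Real.norm_of_nonneg (by positivity)]
    exact (div_lt_one hrpos).mpr hr1
  -- Since $a,x\ge1$, $a^jx^k\le(ax)^{j+k}$, and $(ax)^{j+k}(|q|/r)^{ax}$ is bounded; this leaves
  -- the convergent $\sum r^{ax}$.
  obtain ⟨C, hC⟩ := (tendsto_pow_const_mul_const_pow_of_abs_lt_one (j + k) hx).bddAbove_range
  refine Summable.of_nonneg_of_le (fun _ => norm_nonneg _) (fun p => ?_)
    ((summable_prod_mul_pow 0 hrn).mul_left C)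
  have h := hC ⟨(p.1 * p.2 : ℕ), rfl⟩
  dsimp only at h
  rw [div_pow, ← mul_div_assoc, div_le_iff₀ (by positivity)] at h
  have h1 : (1 : ℝ) ≤ (p.1 : ℕ) := by exact_mod_cast p.1.pos
  have h2 : (1 : ℝ) ≤ (p.2 : ℕ) := by exact_mod_cast p.2.pos
  rw [norm_mul, norm_mul, norm_pow, norm_pow, norm_pow, Complex.norm_natCast, Complex.norm_natCast,
    pow_zero, one_mul]
  refine le_trans ?_ h
  rw [pow_add]
  push_cast
  gcongr <;> nlinarith

lemma summable_lambert {q : ℂ} (hq : ‖q‖ < 1) (j k : ℕ) :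
    Summable fun p : ℕ+ × ℕ+ => (p.1 : ℂ) ^ j * (p.2 : ℂ) ^ k * q ^ (p.1 * p.2 : ℕ) :=
  (summable_norm_lambert hq j k).of_norm

lemma lambert_zero_right {q : ℂ} (hq : ‖q‖ < 1) (k : ℕ) :
    lambert k 0 q = ∑' n : ℕ, ((ArithmeticFunction.sigma k (n + 1) : ℕ) : ℂ) * q ^ (n + 1) := by
  have h1 := tsum_pnat_eq_tsum_succ
    (f := fun n => ((ArithmeticFunction.sigma k n : ℕ) : ℂ) * q ^ n)
  rw [← h1, ← tsum_prod_pow_eq_tsum_sigma k hq, ← (summable_prod_mul_pow k hq).tsum_prod,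
    lambert, ← (Equiv.prodComm ℕ+ ℕ+).tsum_eq]
  refine tsum_congr fun p => ?_
  simp [mul_comm]

lemma eis_one {q : ℂ} (hq : ‖q‖ < 1) : Eis 1 q = 1 - 24 * lambert 1 0 q := by
  rw [lambert_zero_right hq, Eis]
  norm_num [bernoulli_two]

lemma eis_two {q : ℂ} (hq : ‖q‖ < 1) : Eis 2 q = 1 + 240 * lambert 3 0 q := by
  rw [lambert_zero_right hq, Eis]
  have : bernoulli 4 = -1 / 30 := by
    rw [bernoulli_eq_bernoulli'_of_ne_one (by norm_num), bernoulli'_four]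
  norm_num [this]

lemma hasDerivAt_lambert {q : ℂ} (hq : ‖q‖ < 1) (j k : ℕ) :
    HasDerivAt (lambert j k)
      (∑' p : ℕ+ × ℕ+, (p.1 : ℂ) ^ j * (p.2 : ℂ) ^ k *
        (((p.1 * p.2 : ℕ) : ℂ) * q ^ (p.1 * p.2 - 1 : ℕ))) q := by
  obtain ⟨r, hr1, hr2⟩ := exists_between hq
  have hr0 : 0 < r := (norm_nonneg _).trans_lt hr1
  have hr : ‖(r : ℂ)‖ = r := by rw [Complex.norm_real, Real.norm_of_nonneg hr0.le]
  -- Differentiation brings down $ax$ and lowers the exponent by one, whence the indices $j+1,k+1$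
  -- and the factor $r^{-1}$ in the majorant.
  have hs := (summable_norm_lambert (q := r) (by rwa [hr]) (j + 1) (k + 1)).mul_left r⁻¹
  refine hasDerivAt_tsum_of_isPreconnected hs Metric.isOpen_ball
    (convex_ball (0 : ℂ) r).isPreconnected
    (fun p y _ => (hasDerivAt_pow (p.1 * p.2 : ℕ) y).const_mul _) (fun p y hy => ?_)
    (mem_ball_zero_iff.mpr hr1) (summable_lambert hq j k) (mem_ball_zero_iff.mpr hr1)
  rw [mem_ball_zero_iff] at hy
  have hp : (p.1 * p.2 : ℕ) = (p.1 * p.2 - 1 : ℕ) + 1 := by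
    have := Nat.mul_pos p.1.pos p.2.pos
    omega
  have h1 : r ^ (p.1 * p.2 : ℕ) = r ^ (p.1 * p.2 - 1 : ℕ) * r := by
    conv_lhs => rw [hp]
    rw [pow_succ]
  simp only [norm_mul, norm_pow, hr, Complex.norm_natCast, h1]
  have h2 : ‖y‖ ^ (p.1 * p.2 - 1 : ℕ) ≤ r ^ (p.1 * p.2 - 1 : ℕ) :=
    pow_le_pow_left₀ (norm_nonneg _) hy.le _
  calc _ ≤ (p.1 : ℝ) ^ j * (p.2 : ℝ) ^ k * (((p.1 * p.2 : ℕ) : ℝ) * r ^ (p.1 * p.2 - 1 : ℕ)) := by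
        gcongr
    _ = _ := by
        push_cast
        field_simp
        ring

lemma D_lambert {q : ℂ} (hq : ‖q‖ < 1) (j k : ℕ) :
    D (lambert j k) q = lambert (j + 1) (k + 1) q := by
  rw [D, (hasDerivAt_lambert hq j k).deriv, ← tsum_mul_left, lambert]
  refine tsum_congr fun p => ?_
  have hp : (p.1 * p.2 : ℕ) = (p.1 * p.2 - 1 : ℕ) + 1 := by
    have := Nat.mul_pos p.1.pos p.2.pos
    omega
  conv_rhs => rw [hp, pow_succ q]
  push_cast
  ring

/-- Termwise logarithmic differentiation gives $-\sum nq^n/(1-q^n)$, the Lambert form of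
$-\sum\sigma_1(n)q^n$. -/
lemma D_eulerProd {q : ℂ} (hq : ‖q‖ < 1) :
    D eulerProd q = -lambert 1 0 q * eulerProd q := by
  have hE := eulerProd_ne_zero hq
  have hterm : ∀ n : ℕ, logDeriv (fun z : ℂ => 1 - z ^ (n + 1)) q =
      -((n + 1 : ℕ) * q ^ n) / (1 - q ^ (n + 1)) := fun n => by
    rw [logDeriv_apply, ((hasDerivAt_pow (n + 1) q).const_sub 1).deriv]
    simp
  have hsum0 : Summable fun n : ℕ => ‖-(((n + 1 : ℕ) : ℂ) * q ^ n)‖ := by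
    have h2 := summable_norm_pow_mul_geometric_of_norm_lt_one 1 hq
    have h3 := summable_norm_pow_mul_geometric_of_norm_lt_one 0 hq
    refine Summable.of_nonneg_of_le (fun _ => norm_nonneg _) (fun n => ?_) (h2.add h3)
    rw [norm_neg]
    refine (le_of_eq ?_).trans (norm_add_le _ _)
    push_cast
    ring_nf
  have hsum : Summable fun n : ℕ => logDeriv (fun z : ℂ => 1 - z ^ (n + 1)) q := by
    simp_rw [hterm, div_eq_mul_inv]
    refine hsum0.mul_tendsto_const (c := (1 - 0)⁻¹) ?_
    rw [Nat.cofinite_eq_atTop]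
    exact (((tendsto_pow_atTop_nhds_zero_of_norm_lt_one hq).comp
      (tendsto_add_atTop_nat 1)).const_sub 1).inv₀ (by simp)
  have := logDeriv_tprod_eq_tsum (f := fun (n : ℕ) (z : ℂ) => 1 - z ^ (n + 1))
    Metric.isOpen_ball (mem_ball_zero_iff.mpr hq) (one_sub_pow_ne_zero hq)
    (fun i => by fun_prop) hsum ModularForm.multipliableLocallyUniformlyOn_one_sub_pow hE
  have h2 : q * logDeriv eulerProd q = -lambert 1 0 q := by
    change q * logDeriv (fun z => ∏' n : ℕ, (1 - z ^ (n + 1))) q = _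
    rw [this, lambert_zero_right hq,
      ← tsum_pnat_eq_tsum_succ
        (f := fun n => ((ArithmeticFunction.sigma 1 n : ℕ) : ℂ) * q ^ n),
      ← tsum_pow_div_one_sub_eq_tsum_sigma hq,
      tsum_pnat_eq_tsum_succ (f := fun n => (n : ℂ) ^ 1 * q ^ n / (1 - q ^ n)), ← tsum_mul_left,
      ← tsum_neg]
    refine tsum_congr fun n => ?_
    rw [hterm]
    push_cast
    ring
  rw [← h2, logDeriv_apply, D]
  field_simp

/-! ### The convolution identity for $\sum\sigma_1(n)q^n$, by rearranging sums over quadruples. -/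

/-- Pairs of positive integers, split by the order of the two entries. -/
def trichotomyMap (P : Type*) :
    (ℕ+ × P) ⊕ (((ℕ+ × ℕ+) × P) ⊕ ((ℕ+ × ℕ+) × P)) → (ℕ+ × ℕ+) × P :=
  Sum.elim (fun t => ((t.1, t.1), t.2)) (Sum.elim (fun t => ((t.1.1, t.1.1 + t.1.2), t.2))
    (fun t => ((t.1.1 + t.1.2, t.1.1), t.2)))

lemma trichotomyMap_bijective (P : Type*) : Function.Bijective (trichotomyMap P) := by
  constructor
  · rintro (⟨a, p⟩ | ⟨⟨a, b⟩, p⟩ | ⟨⟨a, b⟩, p⟩) (⟨c, r⟩ | ⟨⟨c, d⟩, r⟩ | ⟨⟨c, d⟩, r⟩) h <;>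
      simp only [trichotomyMap, Sum.elim_inl, Sum.elim_inr, Prod.mk.injEq, ← PNat.coe_inj,
        PNat.add_coe] at h <;>
      (try have := b.pos) <;> (try have := d.pos) <;>
      obtain ⟨⟨h1, h2⟩, rfl⟩ := h
    all_goals
      first
      | (exfalso; omega)
      | (simp only [Sum.inl.injEq, Sum.inr.injEq, Prod.mk.injEq, ← PNat.coe_inj, and_true]; omega)
  · rintro ⟨⟨m, n⟩, p⟩
    rcases lt_trichotomy m n with h | rfl | h
    · exact ⟨Sum.inr (Sum.inl ((m, n - m), p)), by
        simp [trichotomyMap, PNat.add_sub_of_lt h]⟩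
    · exact ⟨Sum.inl (m, p), rfl⟩
    · exact ⟨Sum.inr (Sum.inr ((n, m - n), p)), by
        simp [trichotomyMap, PNat.add_sub_of_lt h]⟩

lemma tsum_trichotomy {P : Type*} {f : (ℕ+ × ℕ+) × P → ℂ} (hf : Summable f) :
    ∑' t, f t = ∑' t : ℕ+ × P, f ((t.1, t.1), t.2) +
      (∑' t : (ℕ+ × ℕ+) × P, f ((t.1.1, t.1.1 + t.1.2), t.2) +
        ∑' t : (ℕ+ × ℕ+) × P, f ((t.1.1 + t.1.2, t.1.1), t.2)) := by
  let e := Equiv.ofBijective _ (trichotomyMap_bijective P)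
  have hs : Summable (f ∘ e) := e.summable_iff.mpr hf
  rw [← e.tsum_eq]
  refine (Summable.tsum_sum (hs.comp_injective Sum.inl_injective)
    (hs.comp_injective Sum.inr_injective)).trans ?_
  congr 1
  exact Summable.tsum_sum
    (hs.comp_injective (Sum.inr_injective.comp Sum.inl_injective))
    (hs.comp_injective (Sum.inr_injective.comp Sum.inr_injective))

lemma succPNat_add_sub {m : ℕ+} (i : Fin (m - 1 : ℕ)) :
    Nat.succPNat i + (m - Nat.succPNat i) = m := by
  refine PNat.add_sub_of_lt ?_
  have := i.2
  rw [← PNat.coe_lt_coe, Nat.succPNat_coe]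
  omega

/-- Pairs of positive integers, fibred by their sum. -/
def sumFiberEquiv : ℕ+ × ℕ+ ≃ Σ m : ℕ+, Fin (m - 1 : ℕ) where
  toFun p := ⟨p.1 + p.2, ⟨p.1 - 1, by
    have := p.1.pos
    have := p.2.pos
    rw [PNat.add_coe]
    omega⟩⟩
  invFun s := (Nat.succPNat s.2, s.1 - Nat.succPNat s.2)
  left_inv := by
    rintro ⟨a, b⟩
    have h1 := a.pos
    have h : Nat.succPNat (a - 1 : ℕ) = a := by
      rw [← PNat.coe_inj, Nat.succPNat_coe]
      omega
    simp only [h, Prod.mk.injEq, true_and]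
    exact add_right_injective a (PNat.add_sub_of_lt (PNat.lt_add_right a b))
  right_inv := by
    rintro ⟨m, i⟩
    have h := succPNat_add_sub i
    refine Sigma.ext h ((Fin.heq_ext_iff (congrArg (fun n : ℕ+ => (n - 1 : ℕ)) h)).mpr ?_)
    simp

/-- A pair with sum $m$ has first entry $i+1$ with $0\le i<m-1$. -/
lemma tsum_sumFiber {Q : Type*} {g : (ℕ+ × ℕ+) × Q → ℂ} (hg : Summable g) (G : ℕ → ℕ+ → Q → ℂ)
    (hG : ∀ a b x, g ((a, b), x) = G a (a + b) x) :
    ∑' t, g t = ∑' s : ℕ+ × Q, ∑ i ∈ Finset.range (s.1 - 1), G (i + 1) s.1 s.2 := by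
  let E : ((Σ m : ℕ+, Fin (m - 1 : ℕ)) × Q) ≃ (ℕ+ × ℕ+) × Q :=
    (sumFiberEquiv.symm.prodCongr (Equiv.refl Q))
  let E' : (Σ s : ℕ+ × Q, Fin (s.1 - 1 : ℕ)) ≃ ((Σ m : ℕ+, Fin (m - 1 : ℕ)) × Q) :=
    { toFun := fun s => (⟨s.1.1, s.2⟩, s.1.2)
      invFun := fun s => ⟨(s.1.1, s.2), s.1.2⟩
      left_inv := fun _ => rfl
      right_inv := fun _ => rfl }
  rw [← (E'.trans E).tsum_eq]
  refine (Summable.tsum_sigma ((E'.trans E).summable_iff.mpr hg)).trans (tsum_congr fun s => ?_)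
  rw [tsum_fintype, ← Fin.sum_univ_eq_sum_range (fun i => G (i + 1) s.1 s.2)]
  refine Finset.sum_congr rfl fun i _ => (hG _ _ _).trans ?_
  rw [succPNat_add_sub i]
  rfl

/-- The weight `q^{ax + by}` of a quadruple `((a, b), (x, y))`. -/
def quadWeight (q : ℂ) (a b x y : ℕ+) : ℂ := q ^ (a * x + b * y : ℕ)

lemma summable_quad {q : ℂ} (hq : ‖q‖ < 1) {g : ℕ+ → ℕ+ → ℂ} {C : ℝ}
    (hg : ∀ a b, ‖g a b‖ ≤ C * ((a : ℝ) ^ 2 * (b : ℝ) ^ 2)) :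
    Summable fun t : (ℕ+ × ℕ+) × (ℕ+ × ℕ+) => g t.1.1 t.1.2 *
      quadWeight q t.1.1 t.1.2 t.2.1 t.2.2 := by
  have h := summable_norm_lambert hq 2 0
  have h2 := (h.mul_of_nonneg h (fun _ => norm_nonneg _) (fun _ => norm_nonneg _)).mul_left C
  rw [← (Equiv.prodProdProdComm ℕ+ ℕ+ ℕ+ ℕ+).summable_iff] at h2
  refine Summable.of_norm_bounded h2 fun t => ?_
  simp only [Function.comp_apply, Equiv.prodProdProdComm_apply, norm_mul, norm_pow,
    Complex.norm_natCast, pow_zero, mul_one, quadWeight, pow_add]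
  calc _ ≤ C * ((t.1.1 : ℝ) ^ 2 * (t.1.2 : ℝ) ^ 2) *
        (‖q‖ ^ (t.1.1 * t.2.1 : ℕ) * ‖q‖ ^ (t.1.2 * t.2.2 : ℕ)) := by
        gcongr
        exact hg _ _
    _ = _ := by ring

lemma summable_quad_swap {q : ℂ} (hq : ‖q‖ < 1) {g : ℕ+ → ℕ+ → ℂ} {C : ℝ}
    (hg : ∀ a b, ‖g a b‖ ≤ C * ((a : ℝ) ^ 2 * (b : ℝ) ^ 2)) :
    Summable fun t : (ℕ+ × ℕ+) × (ℕ+ × ℕ+) => g t.2.1 t.2.2 *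
      quadWeight q t.2.1 t.2.2 t.1.1 t.1.2 :=
  (Equiv.prodComm (ℕ+ × ℕ+) (ℕ+ × ℕ+)).summable_iff.mpr (summable_quad hq hg)

lemma tsum_quad_swap (q : ℂ) (g : ℕ+ → ℕ+ → ℂ) :
    ∑' t : (ℕ+ × ℕ+) × (ℕ+ × ℕ+), g t.2.1 t.2.2 * quadWeight q t.2.1 t.2.2 t.1.1 t.1.2 =
    ∑' t : (ℕ+ × ℕ+) × (ℕ+ × ℕ+), g t.1.1 t.1.2 * quadWeight q t.1.1 t.1.2 t.2.1 t.2.2 :=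
  (Equiv.prodComm (ℕ+ × ℕ+) (ℕ+ × ℕ+)).tsum_eq fun t : (ℕ+ × ℕ+) × (ℕ+ × ℕ+) =>
    g t.1.1 t.1.2 * quadWeight q t.1.1 t.1.2 t.2.1 t.2.2

lemma norm_sq_fst_le (a b : ℕ+) : ‖(a : ℂ) ^ 2‖ ≤ 1 * ((a : ℝ) ^ 2 * (b : ℝ) ^ 2) := by
  have h1 : (1 : ℝ) ≤ (b : ℕ) := by exact_mod_cast b.pos
  rw [norm_pow, Complex.norm_natCast, one_mul]
  exact le_mul_of_one_le_right (by positivity) (one_le_pow₀ h1)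

lemma norm_add_sq_le (a b : ℕ+) :
    ‖((a : ℂ) + b) ^ 2‖ ≤ 4 * ((a : ℝ) ^ 2 * (b : ℝ) ^ 2) := by
  have h1 : (1 : ℝ) ≤ (a : ℕ) := by exact_mod_cast a.pos
  have h2 : (1 : ℝ) ≤ (b : ℕ) := by exact_mod_cast b.pos
  have h3 : ‖(a : ℂ) + b‖ = (a : ℝ) + b := by
    rw [← Nat.cast_add, Complex.norm_natCast, Nat.cast_add]
  rw [norm_pow, h3, show 4 * ((a : ℝ) ^ 2 * (b : ℝ) ^ 2) = (2 * (a * b)) ^ 2 by ring]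
  gcongr
  nlinarith

lemma norm_sub_sq_le (a b : ℕ+) :
    ‖((a : ℂ) - b) ^ 2‖ ≤ 4 * ((a : ℝ) ^ 2 * (b : ℝ) ^ 2) := by
  refine le_trans ?_ (norm_add_sq_le a b)
  rw [norm_pow, norm_pow]
  gcongr
  rw [← Nat.cast_add, Complex.norm_natCast, Nat.cast_add]
  simpa using norm_sub_le (a : ℂ) b

/-- The sum `∑ c² q^{cx + by}` over `y > x`, and equally the sum `∑ (a - b)² q^{ax + by}` over
`a > b`. -/
def quadSumLt (q : ℂ) : ℂ := ∑' t : (ℕ+ × ℕ+) × (ℕ+ × ℕ+),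
  (t.1.2 : ℂ) ^ 2 * quadWeight q (t.1.1 + t.1.2) t.1.1 t.2.1 t.2.2

/-- The sum `∑ c² q^{cx + by}` over `c > b`, and equally the sum `∑ (a + b)² q^{ax + by}` over
`x < y`. -/
def quadSumGt (q : ℂ) : ℂ := ∑' t : (ℕ+ × ℕ+) × (ℕ+ × ℕ+),
  ((t.1.1 : ℂ) + t.1.2) ^ 2 * quadWeight q (t.1.1 + t.1.2) t.1.1 t.2.1 t.2.2

/-- The sum `∑ c² q^{cx + by}` over `y < x`, and equally over `c < b`. -/
def quadSumMid (q : ℂ) : ℂ := ∑' t : (ℕ+ × ℕ+) × (ℕ+ × ℕ+),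
  (t.1.1 : ℂ) ^ 2 * quadWeight q t.1.1 (t.1.1 + t.1.2) t.2.1 t.2.2

lemma tsum_sub_sq {q : ℂ} (hq : ‖q‖ < 1) :
    ∑' t : (ℕ+ × ℕ+) × (ℕ+ × ℕ+), ((t.1.1 : ℂ) - t.1.2) ^ 2 *
      quadWeight q t.1.1 t.1.2 t.2.1 t.2.2 = 2 * quadSumLt q := by
  rw [tsum_trichotomy (summable_quad hq norm_sub_sq_le)]
  have h1 : ∑' t : (ℕ+ × ℕ+) × (ℕ+ × ℕ+),
      ((t.1.1 : ℂ) - ((t.1.1 + t.1.2 : ℕ+) : ℕ)) ^ 2 *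
        quadWeight q t.1.1 (t.1.1 + t.1.2) t.2.1 t.2.2 = quadSumLt q := by
    rw [quadSumLt, ← ((Equiv.refl (ℕ+ × ℕ+)).prodCongr (Equiv.prodComm ℕ+ ℕ+)).tsum_eq]
    refine tsum_congr fun t => ?_
    simp only [Equiv.prodCongr_apply, Equiv.refl_apply, Prod.map, Equiv.prodComm_apply, Prod.swap,
      quadWeight]
    push_cast
    ring
  have h2 : ∑' t : (ℕ+ × ℕ+) × (ℕ+ × ℕ+),
      ((((t.1.1 + t.1.2 : ℕ+) : ℕ) : ℂ) - t.1.1) ^ 2 *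
        quadWeight q (t.1.1 + t.1.2) t.1.1 t.2.1 t.2.2 = quadSumLt q := by
    refine tsum_congr fun t => ?_
    push_cast
    ring
  rw [h1, h2]
  simp [two_mul]

/-- The split is by $x$ against $y$, not $a$ against $b$: for $y=x+z$ the exponent is $(a+b)x+bz$,
so $a+b$ becomes one variable exceeding $b$. -/
lemma tsum_add_sq {q : ℂ} (hq : ‖q‖ < 1) :
    ∑' t : (ℕ+ × ℕ+) × (ℕ+ × ℕ+), ((t.1.1 : ℂ) + t.1.2) ^ 2 *
      quadWeight q t.1.1 t.1.2 t.2.1 t.2.2 =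
    (∑' t : ℕ+ × (ℕ+ × ℕ+), ((t.2.1 : ℂ) + t.2.2) ^ 2 * quadWeight q t.2.1 t.2.2 t.1 t.1) +
      2 * quadSumGt q := by
  rw [← tsum_quad_swap q (fun a b => ((a : ℂ) + b) ^ 2),
    tsum_trichotomy (summable_quad_swap hq norm_add_sq_le)]
  have h1 : ∑' t : (ℕ+ × ℕ+) × (ℕ+ × ℕ+), ((t.2.1 : ℂ) + t.2.2) ^ 2 *
      quadWeight q t.2.1 t.2.2 t.1.1 (t.1.1 + t.1.2) = quadSumGt q := by
    refine Eq.trans (tsum_congr fun t => ?_) (Equiv.tsum_eq ((Equiv.prodComm (ℕ+ × ℕ+) (ℕ+ × ℕ+)).trans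
      ((Equiv.prodComm ℕ+ ℕ+).prodCongr (Equiv.refl (ℕ+ × ℕ+)))) _)
    simp only [Equiv.trans_apply, Equiv.prodCongr_apply, Prod.map, Equiv.prodComm_apply, Prod.swap,
      Equiv.coe_refl, id, quadWeight]
    push_cast
    ring
  have h2 : ∑' t : (ℕ+ × ℕ+) × (ℕ+ × ℕ+), ((t.2.1 : ℂ) + t.2.2) ^ 2 *
      quadWeight q t.2.1 t.2.2 (t.1.1 + t.1.2) t.1.1 = quadSumGt q := by
    refine Eq.trans (tsum_congr fun t => ?_) (Equiv.tsum_eq ((Equiv.prodComm (ℕ+ × ℕ+) (ℕ+ × ℕ+))) _)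
    simp only [Equiv.prodComm_apply, Prod.swap, quadWeight]
    push_cast
    ring
  dsimp only
  rw [h1, h2, two_mul]

/-- The sum $\sum a^2q^{ax+by}$ is split once by $x$ against $y$ and once by $a$ against $b$. Both
splittings contain `quadSumMid`, which cancels, and only the diagonals $a=b$ and $x=y$ remain; these
are simple Lambert series. -/
lemma quadSumLt_sub_quadSumGt {q : ℂ} (hq : ‖q‖ < 1) :
    quadSumLt q - quadSumGt q =
      (∑' t : ℕ+ × (ℕ+ × ℕ+), (t.1 : ℂ) ^ 2 * quadWeight q t.1 t.1 t.2.1 t.2.2) -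
      ∑' t : ℕ+ × (ℕ+ × ℕ+), (t.2.1 : ℂ) ^ 2 * quadWeight q t.2.1 t.2.2 t.1 t.1 := by
  have e := tsum_quad_swap q (fun a _ => (a : ℂ) ^ 2)
  rw [tsum_trichotomy (summable_quad_swap hq norm_sq_fst_le),
    tsum_trichotomy (summable_quad hq norm_sq_fst_le)] at e
  have h1 : ∑' t : (ℕ+ × ℕ+) × (ℕ+ × ℕ+), (t.2.1 : ℂ) ^ 2 *
      quadWeight q t.2.1 t.2.2 t.1.1 (t.1.1 + t.1.2) = quadSumLt q := by
    refine Eq.trans (tsum_congr fun t => ?_) (Equiv.tsum_eq ((Equiv.prodComm (ℕ+ × ℕ+) (ℕ+ × ℕ+)).trans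
      ((Equiv.prodComm ℕ+ ℕ+).prodCongr (Equiv.refl (ℕ+ × ℕ+)))) _)
    simp only [Equiv.trans_apply, Equiv.prodCongr_apply, Prod.map, Equiv.prodComm_apply, Prod.swap,
      Equiv.coe_refl, id, quadWeight]
    push_cast
    ring
  have h2 : ∑' t : (ℕ+ × ℕ+) × (ℕ+ × ℕ+), (t.2.1 : ℂ) ^ 2 *
      quadWeight q t.2.1 t.2.2 (t.1.1 + t.1.2) t.1.1 = quadSumMid q := by
    refine Eq.trans (tsum_congr fun t => ?_) (Equiv.tsum_eq ((Equiv.prodComm (ℕ+ × ℕ+) (ℕ+ × ℕ+)).trans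
      ((Equiv.refl (ℕ+ × ℕ+)).prodCongr (Equiv.prodComm ℕ+ ℕ+))) _)
    simp only [Equiv.trans_apply, Equiv.prodCongr_apply, Prod.map, Equiv.prodComm_apply, Prod.swap,
      Equiv.coe_refl, id, quadWeight]
    push_cast
    ring
  have h3 : ∑' t : (ℕ+ × ℕ+) × (ℕ+ × ℕ+), (((t.1.1 + t.1.2 : ℕ+) : ℕ) : ℂ) ^ 2 *
      quadWeight q (t.1.1 + t.1.2) t.1.1 t.2.1 t.2.2 = quadSumGt q := by
    refine tsum_congr fun t => ?_
    push_cast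
    ring
  dsimp only at e
  rw [h1, h2, h3] at e
  rw [quadSumMid] at e
  linear_combination e

lemma diag_injective {P : Type*} :
    Function.Injective fun t : ℕ+ × P => (((t.1, t.1), t.2) : (ℕ+ × ℕ+) × P) := by
  rintro ⟨a, p⟩ ⟨b, r⟩ h
  simp only [Prod.mk.injEq] at h
  rw [h.1.1, h.2]

lemma sum_range_sq_add (m : ℕ) :
    ∑ i ∈ Finset.range m, (2 * ((i : ℂ) + 1) ^ 2 + ((m : ℂ) + 1) ^ 2) =
      5 / 3 * ((m : ℂ) + 1) ^ 3 - 2 * ((m : ℂ) + 1) ^ 2 + 1 / 3 * ((m : ℂ) + 1) := by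
  have h : ∑ i ∈ Finset.range m, ((i : ℂ) + 1) ^ 2 = (m : ℂ) * (m + 1) * (2 * m + 1) / 6 := by
    induction m with
    | zero => simp
    | succ m ih => rw [Finset.sum_range_succ, ih]; push_cast; ring
  rw [Finset.sum_add_distrib, ← Finset.mul_sum, h, Finset.sum_const, Finset.card_range,
    nsmul_eq_mul]
  ring

lemma tsum_diag_fst {q : ℂ} (hq : ‖q‖ < 1) :
    ∑' t : ℕ+ × (ℕ+ × ℕ+), (t.1 : ℂ) ^ 2 * quadWeight q t.1 t.1 t.2.1 t.2.2 =
      lambert 2 1 q - lambert 2 0 q := by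
  have hs := (summable_quad hq norm_sq_fst_le).comp_injective
    (diag_injective (P := ℕ+ × ℕ+))
  have hs' := (Equiv.prodComm (ℕ+ × ℕ+) ℕ+).summable_iff.mpr hs
  rw [← (Equiv.prodComm (ℕ+ × ℕ+) ℕ+).tsum_eq]
  refine (tsum_sumFiber hs' (fun _ m a => (a : ℂ) ^ 2 * q ^ (a * m : ℕ)) fun a b x => ?_).trans ?_
  · simp only [Function.comp_apply, Equiv.prodComm_apply, Prod.swap, quadWeight, PNat.add_coe,
      mul_add]
  · rw [lambert, lambert, ← (summable_lambert hq 2 1).tsum_sub (summable_lambert hq 2 0),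
      ← (Equiv.prodComm ℕ+ ℕ+).tsum_eq]
    refine tsum_congr fun s => ?_
    simp only [Finset.sum_const, Finset.card_range, nsmul_eq_mul, Equiv.prodComm_apply,
      Prod.fst_swap, Prod.snd_swap]
    rw [Nat.cast_sub (show 1 ≤ (s.2 : ℕ) from s.2.pos)]
    push_cast
    ring

lemma tsum_diag_snd {q : ℂ} (hq : ‖q‖ < 1) :
    (∑' t : ℕ+ × (ℕ+ × ℕ+), ((t.2.1 : ℂ) + t.2.2) ^ 2 * quadWeight q t.2.1 t.2.2 t.1 t.1) +
      2 * (∑' t : ℕ+ × (ℕ+ × ℕ+), (t.2.1 : ℂ) ^ 2 * quadWeight q t.2.1 t.2.2 t.1 t.1) =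
      5 / 3 * lambert 3 0 q - 2 * lambert 2 0 q + 1 / 3 * lambert 1 0 q := by
  have hs1 := (summable_quad_swap hq norm_add_sq_le).comp_injective
    (diag_injective (P := ℕ+ × ℕ+))
  have hs2 := ((summable_quad_swap hq norm_sq_fst_le).comp_injective
    (diag_injective (P := ℕ+ × ℕ+))).mul_left 2
  have hs' := (Equiv.prodComm (ℕ+ × ℕ+) ℕ+).summable_iff.mpr (hs1.add hs2)
  rw [← tsum_mul_left]
  refine (hs1.tsum_add hs2).symm.trans ?_
  rw [← (Equiv.prodComm (ℕ+ × ℕ+) ℕ+).tsum_eq]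
  refine (tsum_sumFiber hs' (fun i m x => (2 * (i : ℂ) ^ 2 + (m : ℂ) ^ 2) * q ^ (m * x : ℕ))
    fun a b x => ?_).trans ?_
  · simp only [Function.comp_apply, Equiv.prodComm_apply, Prod.swap, quadWeight, PNat.add_coe,
      add_mul]
    push_cast
    ring
  · have l3 := (summable_lambert hq 3 0).mul_left (5 / 3)
    have l2 := (summable_lambert hq 2 0).mul_left 2
    have l1 := (summable_lambert hq 1 0).mul_left (1 / 3)
    simp only [lambert]
    rw [← tsum_mul_left, ← tsum_mul_left, ← tsum_mul_left, ← l3.tsum_sub l2,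
      ← (l3.sub l2).tsum_add l1]
    refine tsum_congr fun s => ?_
    obtain ⟨m, hm⟩ : ∃ m : ℕ, (s.1 : ℕ) = m + 1 := ⟨s.1 - 1, by have := s.1.pos; omega⟩
    rw [← Finset.sum_mul, hm, Nat.add_sub_cancel]
    push_cast
    rw [sum_range_sq_add]
    ring

/-- The convolution identity behind Ramanujan's formula for `D E_2`. -/
lemma lambert_sq {q : ℂ} (hq : ‖q‖ < 1) :
    4 * lambert 1 0 q ^ 2 =
      5 / 3 * lambert 3 0 q + 1 / 3 * lambert 1 0 q - 2 * lambert 2 1 q := by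
  have hU : lambert 1 0 q ^ 2 = ∑' t : (ℕ+ × ℕ+) × (ℕ+ × ℕ+), ((t.1.1 : ℂ) * t.1.2) *
      quadWeight q t.1.1 t.1.2 t.2.1 t.2.2 := by
    rw [sq, lambert, tsum_mul_tsum_of_summable_norm (summable_norm_lambert hq 1 0)
      (summable_norm_lambert hq 1 0), ← (Equiv.prodProdProdComm ℕ+ ℕ+ ℕ+ ℕ+).tsum_eq]
    refine tsum_congr fun t => ?_
    simp only [Equiv.prodProdProdComm_apply, quadWeight, pow_add]
    ring
  -- Polarisation: $4ab=(a+b)^2-(a-b)^2$.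
  have h4 : 4 * lambert 1 0 q ^ 2 =
      (∑' t : (ℕ+ × ℕ+) × (ℕ+ × ℕ+), ((t.1.1 : ℂ) + t.1.2) ^ 2 *
        quadWeight q t.1.1 t.1.2 t.2.1 t.2.2) -
      ∑' t : (ℕ+ × ℕ+) × (ℕ+ × ℕ+), ((t.1.1 : ℂ) - t.1.2) ^ 2 *
        quadWeight q t.1.1 t.1.2 t.2.1 t.2.2 := by
    rw [hU, ← tsum_mul_left, ← (summable_quad hq norm_add_sq_le).tsum_sub
      (summable_quad hq norm_sub_sq_le)]
    exact tsum_congr fun t => by ring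
  rw [h4, tsum_add_sq hq, tsum_sub_sq hq]
  have e1 := quadSumLt_sub_quadSumGt hq
  have e2 := tsum_diag_fst hq
  have e3 := tsum_diag_snd hq
  linear_combination e3 - 2 * e1 - 2 * e2

/-! ### Derivatives of $E_2$ and of the theta identities, and values at $q=0$. -/

lemma hasDerivAt_eis_one {q : ℂ} (hq : ‖q‖ < 1) :
    HasDerivAt (Eis 1) (-24 * deriv (lambert 1 0) q) q := by
  have h := ((hasDerivAt_lambert hq 1 0).differentiableAt.hasDerivAt.const_mul 24).const_sub 1
  have h2 : Eis 1 =ᶠ[𝓝 q] fun z => 1 - 24 * lambert 1 0 z := by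
    filter_upwards [Metric.isOpen_ball.mem_nhds (mem_ball_zero_iff.mpr hq)] with z hz
    exact eis_one (mem_ball_zero_iff.mp hz)
  refine (h.congr_of_eventuallyEq h2).congr_deriv (by ring)

/-- Ramanujan's identity `D E_2 = (E_2² - E_4) / 12`. -/
lemma D_eis_one {q : ℂ} (hq : ‖q‖ < 1) : D (Eis 1) q = (Eis 1 q ^ 2 - Eis 2 q) / 12 := by
  have h := D_lambert hq 1 0
  rw [D] at h
  rw [D, (hasDerivAt_eis_one hq).deriv, eis_one hq, eis_two hq]
  linear_combination -24 * h - 12 * lambert_sq hq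

lemma differentiableAt_theta3 {q : ℂ} (hq : ‖q‖ < 1) : DifferentiableAt ℂ theta3 q :=
  differentiableOn_theta3.differentiableAt
    (Metric.isOpen_ball.mem_nhds (mem_ball_zero_iff.mpr hq))

lemma theta4_eq_comp : theta4 = fun q => theta3 (-q) := funext theta4_eq_theta3_neg

lemma differentiableOn_theta4 : DifferentiableOn ℂ theta4 (Metric.ball 0 1) := by
  rw [theta4_eq_comp]
  exact differentiableOn_theta3.comp (differentiableOn_neg _) fun z hz => by simpa using hz

lemma differentiableAt_theta4 {q : ℂ} (hq : ‖q‖ < 1) : DifferentiableAt ℂ theta4 q :=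
  differentiableOn_theta4.differentiableAt
    (Metric.isOpen_ball.mem_nhds (mem_ball_zero_iff.mpr hq))

lemma differentiableAt_eulerProd {q : ℂ} (hq : ‖q‖ < 1) : DifferentiableAt ℂ eulerProd q :=
  ModularForm.differentiableOn_tprod_one_sub_pow.differentiableAt
    (Metric.isOpen_ball.mem_nhds (mem_ball_zero_iff.mpr hq))

lemma eventually_norm_lt_one {q : ℂ} (hq : ‖q‖ < 1) : ∀ᶠ z in 𝓝 q, ‖z‖ < 1 := by
  filter_upwards [Metric.isOpen_ball.mem_nhds (mem_ball_zero_iff.mpr hq)] with z hz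
  exact mem_ball_zero_iff.mp hz

/-- Two functions agreeing on the unit disc have the same derivative there. -/
lemma deriv_unique {f g : ℂ → ℂ} {a b q : ℂ} (hq : ‖q‖ < 1) (h : ∀ z, ‖z‖ < 1 → f z = g z)
    (hf : HasDerivAt f a q) (hg : HasDerivAt g b q) : a = b :=
  hf.unique (hg.congr_of_eventuallyEq ((eventually_norm_lt_one hq).mono h))

lemma hasDerivAt_comp_sq {f : ℂ → ℂ} {q : ℂ} (hf : DifferentiableAt ℂ f (q ^ 2)) :
    HasDerivAt (fun z => f (z ^ 2)) (deriv f (q ^ 2) * (2 * q)) q := by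
  have h := hasDerivAt_pow 2 q
  simp only [Nat.cast_ofNat, Nat.add_one_sub_one, pow_one] at h
  exact hf.hasDerivAt.comp q h

lemma D_theta_sum {q : ℂ} (hq : ‖q‖ < 1) :
    theta3 q * D theta3 q + theta4 q * D theta4 q = 4 * (theta3 (q ^ 2) * D theta3 (q ^ 2)) := by
  have hQ := norm_sq_lt_one hq
  have h := deriv_unique hq (fun z hz => theta3_sq_add_theta4_sq hz)
    (((differentiableAt_theta3 hq).hasDerivAt.pow 2).add
      ((differentiableAt_theta4 hq).hasDerivAt.pow 2))
    (((hasDerivAt_comp_sq (differentiableAt_theta3 hQ)).pow 2).const_mul 2)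
  simp only [D]
  simp only [Nat.cast_ofNat, Nat.add_one_sub_one, pow_one] at h
  linear_combination q / 2 * h

lemma D_theta_prod {q : ℂ} (hq : ‖q‖ < 1) :
    D theta3 q * theta4 q + theta3 q * D theta4 q = 4 * (theta4 (q ^ 2) * D theta4 (q ^ 2)) := by
  have hQ := norm_sq_lt_one hq
  have h := deriv_unique hq (fun z hz => theta3_mul_theta4 hz)
    ((differentiableAt_theta3 hq).hasDerivAt.mul (differentiableAt_theta4 hq).hasDerivAt)
    ((hasDerivAt_comp_sq (differentiableAt_theta4 hQ)).pow 2)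
  simp only [D]
  simp only [Nat.cast_ofNat, Nat.add_one_sub_one, pow_one] at h
  linear_combination q * h

/-- The logarithmic derivative of Gauss's formula. -/
lemma D_theta4_eq_lambert {q : ℂ} (hq : ‖q‖ < 1) :
    D theta4 q = theta4 q * (2 * lambert 1 0 (q ^ 2) - 2 * lambert 1 0 q) := by
  have hQ := norm_sq_lt_one hq
  have h := deriv_unique hq (fun z hz => theta4_mul_eulerProd hz)
    ((differentiableAt_theta4 hq).hasDerivAt.mul
      (hasDerivAt_comp_sq (differentiableAt_eulerProd hQ)))
    ((differentiableAt_eulerProd hq).hasDerivAt.pow 2)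
  simp only [Nat.cast_ofNat, Nat.add_one_sub_one, pow_one] at h
  have e1 := D_eulerProd hq
  have e2 := D_eulerProd hQ
  have e3 := theta4_mul_eulerProd hq
  simp only [D] at e1 e2 ⊢
  refine mul_right_cancel₀ (eulerProd_ne_zero hQ) ?_
  linear_combination q * h - 2 * theta4 q * e2 + 2 * eulerProd q * e1 + 2 * lambert 1 0 q * e3

lemma D_theta4_eq_eis {q : ℂ} (hq : ‖q‖ < 1) :
    D theta4 q = theta4 q * ((Eis 1 q - Eis 1 (q ^ 2)) / 12) := by
  rw [D_theta4_eq_lambert hq, eis_one hq, eis_one (norm_sq_lt_one hq)]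
  ring

lemma theta3_zero : theta3 0 = 1 := by
  rw [theta3, tsum_eq_single 0]
  · simp
  · intro m hm
    have : 0 < m ^ 2 := by positivity
    exact zero_pow (by omega)

lemma theta4_zero : theta4 0 = 1 := by rw [theta4_eq_theta3_neg, neg_zero, theta3_zero]

lemma lambert_at_zero (j k : ℕ) : lambert j k 0 = 0 := by
  refine (tsum_congr fun p => ?_).trans tsum_zero
  rw [zero_pow (Nat.mul_pos p.1.pos p.2.pos).ne', mul_zero]

lemma deriv_lambert_zero : deriv (lambert 1 0) 0 = 1 := by
  rw [(hasDerivAt_lambert (by simp) 1 0).deriv, tsum_eq_single (1, 1)]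
  · simp
  · rintro ⟨a, b⟩ h
    have : (a * b : ℕ) - 1 ≠ 0 := fun h0 => h <| by
      have h1 : (a * b : ℕ) = 1 := by
        have := Nat.mul_pos a.pos b.pos
        omega
      have h2 := Nat.eq_one_of_mul_eq_one_right h1
      have h3 := Nat.eq_one_of_mul_eq_one_left h1
      rw [Prod.mk.injEq]
      exact ⟨PNat.coe_inj.mp h2, PNat.coe_inj.mp h3⟩
    simp [zero_pow this]

lemma norm_zero_lt_one : ‖(0 : ℂ)‖ < 1 := by simp

/-- Since $D$ loses the derivative at $0$, the equation for $q\theta_4'$ is itself differentiated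
there. -/
lemma deriv_theta4_zero : deriv theta4 0 = -2 := by
  have h1 : DifferentiableAt ℂ (deriv theta4) 0 :=
    (differentiableOn_theta4.deriv Metric.isOpen_ball).differentiableAt
      (Metric.isOpen_ball.mem_nhds (by simp))
  have hl := (hasDerivAt_lambert norm_zero_lt_one 1 0).differentiableAt
  have h := deriv_unique norm_zero_lt_one (fun z hz => D_theta4_eq_lambert hz)
    ((hasDerivAt_id 0).mul h1.hasDerivAt)
    ((differentiableAt_theta4 norm_zero_lt_one).hasDerivAt.mul
      (((hasDerivAt_comp_sq (q := 0) (by simpa using hl)).const_mul 2).sub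
        (hl.hasDerivAt.const_mul 2)))
  simpa [lambert_at_zero, theta4_zero, deriv_lambert_zero] using h

lemma deriv_theta3_zero : deriv theta3 0 = 2 := by
  have h := deriv_theta4_zero
  rw [theta4_eq_comp, deriv_comp_neg, neg_zero] at h
  linear_combination -h

lemma tendsto_pow_two_pow {q : ℂ} (hq : ‖q‖ < 1) :
    Tendsto (fun n : ℕ => q ^ 2 ^ n) atTop (𝓝 0) :=
  (tendsto_pow_atTop_nhds_zero_of_norm_lt_one hq).comp (tendsto_pow_atTop_atTop_of_one_lt one_lt_two)

lemma norm_pow_two_pow_lt_one {q : ℂ} (hq : ‖q‖ < 1) (n : ℕ) : ‖q ^ 2 ^ n‖ < 1 := by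
  rw [norm_pow]; exact pow_lt_one₀ (norm_nonneg _) hq (by positivity)

/-! ### Rigidity under $q\mapsto q^2$ and its consequences for $\theta_3$, $G_2$ and $E_4$. -/

/-- A function on the punctured disc invariant under `q ↦ q²` equals its limit at `0`. -/
lemma eq_of_invariant_sq {f : ℂ → ℂ} {c : ℂ} (hf : ∀ q, ‖q‖ < 1 → q ≠ 0 → f q = f (q ^ 2))
    (hc : Tendsto f (𝓝[≠] 0) (𝓝 c)) {q : ℂ} (hq : ‖q‖ < 1) (hq0 : q ≠ 0) : f q = c := by
  have h : ∀ n : ℕ, f (q ^ 2 ^ n) = f q := fun n => by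
    induction n with
    | zero => simp
    | succ n ih =>
      rw [pow_succ, pow_mul, ← hf _ (norm_pow_two_pow_lt_one hq n) (pow_ne_zero _ hq0), ih]
  have ht : Tendsto (fun n : ℕ => f (q ^ 2 ^ n)) atTop (𝓝 c) :=
    hc.comp (tendsto_nhdsWithin_iff.mpr
      ⟨tendsto_pow_two_pow hq, Eventually.of_forall fun n => pow_ne_zero _ hq0⟩)
  simp_rw [h] at ht
  exact tendsto_nhds_unique tendsto_const_nhds ht

/-- A function with `f(q) = 4 f(q²)` that vanishes at `0` and is differentiable there is zero. -/
lemma eq_zero_of_four_mul_sq {f : ℂ → ℂ} (hf : ∀ q, ‖q‖ < 1 → f q = 4 * f (q ^ 2))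
    (h0 : f 0 = 0) (hd : DifferentiableAt ℂ f 0) {q : ℂ} (hq : ‖q‖ < 1) : f q = 0 := by
  -- The factor $4^n$ is written as $(2^n)^2$, so that the bound $f(z)=O(z)$ leaves $m^2q^m\to0$
  -- along $m=2^n$.
  have h : ∀ n : ℕ, ((2 ^ n : ℕ) : ℂ) ^ 2 * f (q ^ 2 ^ n) = f q := fun n => by
    induction n with
    | zero => simp
    | succ n ih =>
      have e := hf _ (norm_pow_two_pow_lt_one hq n)
      rw [← pow_mul, ← pow_succ] at e
      rw [← ih, e]
      push_cast
      ring
  have hO : (fun n : ℕ => f (q ^ 2 ^ n)) =O[atTop] fun n : ℕ => q ^ 2 ^ n := by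
    have := hd.isBigO_sub
    simp only [h0, sub_zero] at this
    exact this.comp_tendsto (tendsto_pow_two_pow hq)
  have hlim : Tendsto (fun n : ℕ => ((2 ^ n : ℕ) : ℂ) ^ 2 * q ^ 2 ^ n) atTop (𝓝 0) := by
    have h1 := (summable_norm_pow_mul_geometric_of_norm_lt_one 2 hq).of_norm.tendsto_atTop_zero
    exact h1.comp (tendsto_pow_atTop_atTop_of_one_lt one_lt_two)
  have := ((Asymptotics.isBigO_refl (fun n : ℕ => ((2 ^ n : ℕ) : ℂ) ^ 2) atTop).mul hO).trans_tendsto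
    hlim
  simp_rw [h] at this
  exact tendsto_nhds_unique tendsto_const_nhds this

/-- `D log θ_3 - D log θ_4 = θ_2^4 / 4`, with denominators cleared. -/
lemma theta_wronskian {q : ℂ} (hq : ‖q‖ < 1) :
    4 * (theta3 q * D theta4 q - theta4 q * D theta3 q) =
      -((theta3 q ^ 4 - theta4 q ^ 4) * (theta3 q * theta4 q)) := by
  rcases eq_or_ne q 0 with rfl | hq0
  · simp [D, theta3_zero, theta4_zero]
  let f : ℂ → ℂ := fun z => (theta3 z * D theta4 z - theta4 z * D theta3 z) /
    (theta3 z * theta4 z * (theta3 z ^ 4 - theta4 z ^ 4))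
  have hf : ∀ z, ‖z‖ < 1 → z ≠ 0 → f z = f (z ^ 2) := fun z hz _ => by
    have hz2 := norm_sq_lt_one hz
    have e1 := D_theta_sum hz
    have e2 := D_theta_prod hz
    have e3 := theta3_sq_add_theta4_sq hz
    have e4 := theta3_mul_theta4 hz
    have n1 := theta3_ne_zero hz
    have n2 := theta4_ne_zero hz
    have n3 := theta3_ne_zero hz2
    have n4 := theta4_ne_zero hz2
    have eb : theta3 (z ^ 2) ^ 4 - theta4 (z ^ 2) ^ 4 = (theta3 z ^ 2 - theta4 z ^ 2) ^ 2 / 4 := by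
      have h3 : theta3 (z ^ 2) ^ 2 = (theta3 z ^ 2 + theta4 z ^ 2) / 2 := by
        linear_combination -e3 / 2
      rw [show theta3 (z ^ 2) ^ 4 = (theta3 (z ^ 2) ^ 2) ^ 2 by ring,
        show theta4 (z ^ 2) ^ 4 = (theta4 (z ^ 2) ^ 2) ^ 2 by ring, h3, ← e4]
      ring
    have eN : 8 * (theta3 (z ^ 2) * theta4 (z ^ 2)) *
        (theta3 (z ^ 2) * D theta4 (z ^ 2) - theta4 (z ^ 2) * D theta3 (z ^ 2)) =
        (theta3 z ^ 2 - theta4 z ^ 2) * (theta3 z * D theta4 z - theta4 z * D theta3 z) := by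
      linear_combination -2 * theta3 (z ^ 2) ^ 2 * e2 + 2 * theta4 (z ^ 2) ^ 2 * e1
        - (D theta3 z * theta4 z + theta3 z * D theta4 z) * e3
        + 2 * (theta3 z * D theta3 z + theta4 z * D theta4 z) * e4
    simp only [f]
    -- If $\theta_3^2=\theta_4^2$ at $z$, the denominators at $z$ and at $z^2$ both vanish, and both
    -- quotients are $0$ by convention.
    rcases eq_or_ne (theta3 z ^ 2 - theta4 z ^ 2) 0 with h0 | h0
    · rw [eb, h0, show theta3 z ^ 4 - theta4 z ^ 4 =
        (theta3 z ^ 2 - theta4 z ^ 2) * (theta3 z ^ 2 + theta4 z ^ 2) by ring, h0]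
      simp
    · have n5 : theta3 z ^ 2 + theta4 z ^ 2 ≠ 0 := by
        rw [e3]; exact mul_ne_zero two_ne_zero (pow_ne_zero _ n3)
      rw [eb, show theta3 z ^ 4 - theta4 z ^ 4 =
        (theta3 z ^ 2 - theta4 z ^ 2) * (theta3 z ^ 2 + theta4 z ^ 2) by ring]
      rw [div_eq_div_iff (by simp [*]) (by simp [*])]
      have hk : 2 * (theta3 (z ^ 2) * theta4 (z ^ 2)) ^ 2 =
          (theta3 z ^ 2 + theta4 z ^ 2) * (theta3 z * theta4 z) := by
        rw [e3, e4]; ring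
      refine mul_left_cancel₀ (mul_ne_zero n3 n4) ?_
      linear_combination (theta3 z * D theta4 z - theta4 z * D theta3 z) *
        (theta3 z ^ 2 - theta4 z ^ 2) ^ 2 / 8 * hk -
        (theta3 z * theta4 z) * (theta3 z ^ 2 - theta4 z ^ 2) *
          (theta3 z ^ 2 + theta4 z ^ 2) / 8 * eN
  -- After division by $z$, the numerator tends to $-2-2=-4$ and the denominator to
  -- $4\cdot2-4\cdot(-2)=16$.
  have hc : Tendsto f (𝓝[≠] 0) (𝓝 (-1 / 4)) := by
    have c3 : ContinuousAt (deriv theta3) 0 :=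
      ((differentiableOn_theta3.deriv Metric.isOpen_ball).differentiableAt
        (Metric.isOpen_ball.mem_nhds (by simp))).continuousAt
    have c4 : ContinuousAt (deriv theta4) 0 :=
      ((differentiableOn_theta4.deriv Metric.isOpen_ball).differentiableAt
        (Metric.isOpen_ball.mem_nhds (by simp))).continuousAt
    have d3 := differentiableAt_theta3 norm_zero_lt_one
    have d4 := differentiableAt_theta4 norm_zero_lt_one
    have hb : HasDerivAt (fun z => theta3 z ^ 4 - theta4 z ^ 4) 16 0 := by
      refine ((d3.hasDerivAt.pow 4).sub (d4.hasDerivAt.pow 4)).congr_deriv ?_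
      rw [theta3_zero, theta4_zero, deriv_theta3_zero, deriv_theta4_zero]
      norm_num
    have hslope := hasDerivAt_iff_tendsto_slope.mp hb
    have hnum : Tendsto (fun z => theta3 z * deriv theta4 z - theta4 z * deriv theta3 z)
        (𝓝[≠] 0) (𝓝 (-4)) := by
      have h : ContinuousAt (fun z => theta3 z * deriv theta4 z - theta4 z * deriv theta3 z) 0 :=
        (d3.continuousAt.mul c4).sub (d4.continuousAt.mul c3)
      have h2 := h.tendsto.mono_left (nhdsWithin_le_nhds (s := {0}ᶜ))
      rw [theta3_zero, theta4_zero, deriv_theta3_zero, deriv_theta4_zero] at h2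
      norm_num at h2
      exact h2
    have hden : Tendsto (fun z => theta3 z * theta4 z) (𝓝[≠] 0) (𝓝 1) := by
      have h : ContinuousAt (fun z => theta3 z * theta4 z) 0 :=
        d3.continuousAt.mul d4.continuousAt
      have h2 := h.tendsto.mono_left (nhdsWithin_le_nhds (s := {0}ᶜ))
      simpa only [theta3_zero, theta4_zero, mul_one] using h2
    have h := hnum.div (hden.mul hslope) (by norm_num)
    norm_num at h
    rw [show (-1 / 4 : ℂ) = -(1 / 4) by ring]
    refine h.congr' ?_
    filter_upwards [self_mem_nhdsWithin] with z hz
    have hz : z ≠ 0 := hz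
    simp only [f, D, Pi.div_apply, slope_def_field, theta3_zero, theta4_zero, one_pow]
    rw [sub_zero, sub_self, sub_zero, mul_div_assoc', div_div_eq_mul_div]
    congr 1
    ring
  have h := eq_of_invariant_sq hf hc hq hq0
  -- A vanishing denominator would give $f(q)=0$, contradicting $f(q)=-1/4$.
  have hne : theta3 q * theta4 q * (theta3 q ^ 4 - theta4 q ^ 4) ≠ 0 := fun h0 => by
    simp only [f, h0, div_zero] at h
    norm_num at h
  simp only [f] at h
  rw [div_eq_iff hne] at h
  linear_combination 4 * h

lemma D_theta3_eq {q : ℂ} (hq : ‖q‖ < 1) :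
    D theta3 q = theta3 q * ((Eis 1 q - Eis 1 (q ^ 2)) / 12 +
      (theta3 q ^ 4 - theta4 q ^ 4) / 4) := by
  have h := theta_wronskian hq
  have h4 := D_theta4_eq_eis hq
  refine mul_left_cancel₀ (theta4_ne_zero hq) ?_
  linear_combination theta3 q * h4 - h / 4

lemma differentiableAt_eis_one {q : ℂ} (hq : ‖q‖ < 1) : DifferentiableAt ℂ (Eis 1) q :=
  (hasDerivAt_eis_one hq).differentiableAt

lemma theta_pow_four_sq {q : ℂ} (hq : ‖q‖ < 1) :
    2 * theta3 (q ^ 2) ^ 4 - theta4 (q ^ 2) ^ 4 = (theta3 q ^ 4 + theta4 q ^ 4) / 2 := by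
  have e3 := theta3_sq_add_theta4_sq hq
  have e4 := theta3_mul_theta4 hq
  linear_combination -(theta3 q ^ 2 + theta4 q ^ 2 + 2 * theta3 (q ^ 2) ^ 2) / 2 * e3 +
    (theta3 q * theta4 q + theta4 (q ^ 2) ^ 2) * e4

/-- The logarithmic derivative of $\theta_3(q)\theta_4(q)=\theta_4(q^2)^2$. It makes the defect in
the formula for $G_2$ invariant under $q\mapsto q^2$. -/
lemma eis_one_sub_eis_one_sq {q : ℂ} (hq : ‖q‖ < 1) :
    4 * (Eis 1 (q ^ 2) - Eis 1 ((q ^ 2) ^ 2)) =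
      2 * (Eis 1 q - Eis 1 (q ^ 2)) + 3 * (theta3 q ^ 4 - theta4 q ^ 4) := by
  have h := D_theta_prod hq
  have e4 := theta3_mul_theta4 hq
  have n3 := theta3_ne_zero hq
  have n4 := theta4_ne_zero hq
  rw [D_theta3_eq hq, D_theta4_eq_eis hq, D_theta4_eq_eis (norm_sq_lt_one hq)] at h
  refine mul_left_cancel₀ (mul_ne_zero n3 n4) ?_
  linear_combination -12 * h + 4 * (Eis 1 (q ^ 2) - Eis 1 ((q ^ 2) ^ 2)) * e4

lemma eis_one_zero : Eis 1 0 = 1 := by rw [eis_one norm_zero_lt_one, lambert_at_zero]; ring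

lemma eis_two_zero : Eis 2 0 = 1 := by rw [eis_two norm_zero_lt_one, lambert_at_zero]; ring

/-- `G_2 = θ_3^4 + θ_2^4`, with `θ_2^4` replaced by `θ_3^4 - θ_4^4`. -/
lemma G2_eq_theta {q : ℂ} (hq : ‖q‖ < 1) : G2 q = 2 * theta3 q ^ 4 - theta4 q ^ 4 := by
  have hd := differentiableAt_eis_one norm_zero_lt_one
  let f : ℂ → ℂ := fun z => Eis 1 z - 2 * Eis 1 (z ^ 2) + 2 * theta3 z ^ 4 - theta4 z ^ 4
  have hf : ∀ z, ‖z‖ < 1 → z ≠ 0 → f z = f (z ^ 2) := fun z hz _ => by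
    have h1 := theta_pow_four_sq hz
    have h2 := eis_one_sub_eis_one_sq hz
    simp only [f]
    linear_combination -h1 - h2 / 2
  have hc : ContinuousAt f 0 := by
    have h1 := (differentiableAt_theta3 norm_zero_lt_one).continuousAt
    have h2 := (differentiableAt_theta4 norm_zero_lt_one).continuousAt
    have h3 : ContinuousAt (fun z => Eis 1 (z ^ 2)) 0 :=
      (hasDerivAt_comp_sq (q := 0) (by simpa using hd)).continuousAt
    exact ((hd.continuousAt.sub (h3.const_mul 2)).add ((h1.pow 4).const_mul 2)).sub (h2.pow 4)
  have hf0 : f 0 = 0 := by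
    simp only [f]
    rw [zero_pow two_ne_zero, theta3_zero, theta4_zero, eis_one_zero]
    norm_num
  have key : f q = 0 := by
    rcases eq_or_ne q 0 with rfl | hq0
    · exact hf0
    · have ht := hc.tendsto.mono_left (nhdsWithin_le_nhds (s := {0}ᶜ))
      rw [hf0] at ht
      exact eq_of_invariant_sq hf ht hq hq0
  simp only [f] at key
  rw [G2]
  linear_combination -key

lemma eis_one_sq_eq {q : ℂ} (hq : ‖q‖ < 1) :
    Eis 1 (q ^ 2) = (Eis 1 q + (2 * theta3 q ^ 4 - theta4 q ^ 4)) / 2 := by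
  have h := G2_eq_theta hq
  rw [G2] at h
  linear_combination h / 2

/-- `D log θ_4 = (E_2 - G_2) / 24`. -/
lemma D_theta4 {q : ℂ} (hq : ‖q‖ < 1) : D theta4 q = theta4 q * ((Eis 1 q - G2 q) / 24) := by
  rw [D_theta4_eq_eis hq, G2]
  ring

lemma D_theta3' {q : ℂ} (hq : ‖q‖ < 1) :
    D theta3 q = theta3 q * ((Eis 1 q + 4 * theta3 q ^ 4 - 5 * theta4 q ^ 4) / 24) := by
  rw [D_theta3_eq hq, eis_one_sq_eq hq]
  ring

lemma hasDerivAt_G2 {q : ℂ} (hq : ‖q‖ < 1) :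
    HasDerivAt G2 (8 * theta3 q ^ 3 * deriv theta3 q - 4 * theta4 q ^ 3 * deriv theta4 q) q := by
  have h := (((differentiableAt_theta3 hq).hasDerivAt.pow 4).const_mul 2).sub
    ((differentiableAt_theta4 hq).hasDerivAt.pow 4)
  refine (h.congr_of_eventuallyEq ((eventually_norm_lt_one hq).mono
    fun z hz => G2_eq_theta hz)).congr_deriv ?_
  norm_num
  ring

lemma D_G2_theta {q : ℂ} (hq : ‖q‖ < 1) :
    D G2 q = 8 * theta3 q ^ 3 * D theta3 q - 4 * theta4 q ^ 3 * D theta4 q := by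
  simp only [D]
  rw [(hasDerivAt_G2 hq).deriv]
  ring

lemma D_G2_eis {q : ℂ} (hq : ‖q‖ < 1) :
    D G2 q = 4 * D (Eis 1) (q ^ 2) - D (Eis 1) q := by
  have h := ((hasDerivAt_comp_sq (differentiableAt_eis_one (norm_sq_lt_one hq))).const_mul 2).sub
    (differentiableAt_eis_one hq).hasDerivAt
  have h2 : deriv G2 q = _ := h.deriv
  simp only [D, h2]
  ring

lemma differentiableAt_eis_two {q : ℂ} (hq : ‖q‖ < 1) : DifferentiableAt ℂ (Eis 2) q := by
  have h := ((hasDerivAt_lambert hq 3 0).const_mul 240).const_add 1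
  exact (h.congr_of_eventuallyEq ((eventually_norm_lt_one hq).mono
    fun z hz => eis_two hz)).differentiableAt

/-- `E_4 = a² + 14ab + b²` with `a = θ_3^4` and `b = θ_2^4 = θ_3^4 - θ_4^4`. -/
lemma eis_two_eq_theta {q : ℂ} (hq : ‖q‖ < 1) :
    Eis 2 q = 16 * theta3 q ^ 8 - 16 * theta3 q ^ 4 * theta4 q ^ 4 + theta4 q ^ 8 := by
  let f : ℂ → ℂ := fun z =>
    Eis 2 z - (16 * theta3 z ^ 8 - 16 * theta3 z ^ 4 * theta4 z ^ 4 + theta4 z ^ 8)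
  have hf : ∀ z, ‖z‖ < 1 → f z = 4 * f (z ^ 2) := fun z hz => by
    -- $DG_2$ is computed in two ways: from the theta expression, and from $DE_2$ at $z$ and $z^2$.
    -- The second brings in $E_4(z)$ and $4E_4(z^2)$, which gives $f(z)=4f(z^2)$.
    have h1 := D_G2_theta hz
    rw [D_G2_eis hz, D_eis_one hz, D_eis_one (norm_sq_lt_one hz), D_theta3' hz, D_theta4 hz,
      eis_one_sq_eq hz, G2_eq_theta hz] at h1
    have h2 := theta_pow_four_sq hz
    have h4 : theta4 (z ^ 2) ^ 4 = (theta3 z * theta4 z) ^ 2 := by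
      rw [theta3_mul_theta4 hz]; ring
    have h3 : theta3 (z ^ 2) ^ 4 = ((theta3 z ^ 2 + theta4 z ^ 2) / 2) ^ 2 := by
      rw [theta3_sq_add_theta4_sq hz]; ring
    simp only [f]
    rw [show theta3 (z ^ 2) ^ 8 = (theta3 (z ^ 2) ^ 4) ^ 2 by ring,
      show theta4 (z ^ 2) ^ 8 = (theta4 (z ^ 2) ^ 4) ^ 2 by ring, h3, h4]
    linear_combination 12 * h1
  have hf0 : f 0 = 0 := by
    simp only [f]
    rw [theta3_zero, theta4_zero, eis_two_zero]
    norm_num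
  have h3 := differentiableAt_theta3 norm_zero_lt_one
  have h4 := differentiableAt_theta4 norm_zero_lt_one
  have hd : DifferentiableAt ℂ f 0 :=
    (differentiableAt_eis_two norm_zero_lt_one).sub
      ((((h3.pow 8).const_mul 16).sub (((h3.pow 4).const_mul 16).mul (h4.pow 4))).add (h4.pow 8))
  exact sub_eq_zero.mp (eq_zero_of_four_mul_sq hf hf0 hd hq)

lemma D_G2 {q : ℂ} (hq : ‖q‖ < 1) :
    D G2 q = Eis 1 q * G2 q / 6 - G2 q ^ 2 / 3 + Eis 2 q / 6 := by
  rw [D_G2_theta hq, D_theta3' hq, D_theta4 hq, eis_two_eq_theta hq, G2_eq_theta hq]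
  ring

lemma D_eis_two {q : ℂ} (hq : ‖q‖ < 1) :
    D (Eis 2) q = Eis 1 q * Eis 2 q / 3 + G2 q * Eis 2 q - 4 / 3 * G2 q ^ 3 := by
  have h3 := (differentiableAt_theta3 hq).hasDerivAt
  have h4 := (differentiableAt_theta4 hq).hasDerivAt
  have h := deriv_unique hq (fun z hz => eis_two_eq_theta hz)
    (differentiableAt_eis_two hq).hasDerivAt
    ((((h3.pow 8).const_mul 16).sub (((h3.pow 4).const_mul 16).mul (h4.pow 4))).add (h4.pow 8))
  have e : D (Eis 2) q = (128 * theta3 q ^ 7 - 64 * theta3 q ^ 3 * theta4 q ^ 4) * D theta3 q +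
      (8 * theta4 q ^ 7 - 64 * theta3 q ^ 4 * theta4 q ^ 3) * D theta4 q := by
    simp only [D, h]
    norm_num
    ring
  rw [e, D_theta3' hq, D_theta4 hq, eis_two_eq_theta hq, G2_eq_theta hq]
  ring

lemma G2_eq_Theta {q : ℂ} (hq : ‖q‖ < 1) : G2 q = Theta 0 1 q := by
  rw [G2_eq_theta hq, Theta]
  simp only [mul_zero, pow_zero, one_mul, mul_one]
  rw [theta2_pow_four hq]
  ring

/-! ### The coefficient recursion and the induction on $t$. -/

/-- Exponents `(α, β, γ)` with `α + β + 2γ = t`. -/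
def exponents (t : ℕ) : Finset (ℕ × ℕ × ℕ) :=
  (Finset.range (t + 1) ×ˢ Finset.range (t + 1) ×ˢ Finset.range (t + 1)).filter
    (fun x : ℕ × ℕ × ℕ => x.1 + x.2.1 + 2 * x.2.2 = t)

lemma mem_exponents {t : ℕ} {x : ℕ × ℕ × ℕ} :
    x ∈ exponents t ↔ x.1 + x.2.1 + 2 * x.2.2 = t := by
  simp only [exponents, Finset.mem_filter, Finset.mem_product, Finset.mem_range]
  omega

lemma cTilde_eq_zero {α β γ : ℤ} (h : α < 0 ∨ β < 0 ∨ γ < 0) : cTilde α β γ = 0 := by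
  rw [cTilde, if_pos h]

lemma cTilde_zero : cTilde 0 0 0 = 1 := by rw [cTilde]; simp

/-- Shifting the exponents by a vector of weight one. -/
lemma sum_exponents_shift {t : ℕ} {w : ℤ → ℤ → ℤ → ℂ} {d e f : ℤ} (hd : d + e + 2 * f = 1)
    (h1 : ∀ α β γ, α < 0 ∨ β < 0 ∨ γ < 0 → w α β γ = 0)
    (h2 : ∀ α β γ, α < 0 ∨ β < 0 ∨ γ < 0 → w (α + d) (β + e) (γ + f) = 0) :
    ∑ x ∈ exponents t, w (x.1 + d) (x.2.1 + e) (x.2.2 + f) =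
      ∑ x ∈ exponents (t + 1), w x.1 x.2.1 x.2.2 := by
  have nonneg : ∀ {α β γ : ℤ}, w α β γ ≠ 0 → 0 ≤ α ∧ 0 ≤ β ∧ 0 ≤ γ := fun {α β γ} h => by
    by_contra hn
    exact h (h1 α β γ (by omega))
  -- `h1` removes the terms shifted out of the octant, `h2` those with no preimage in it; the others
  -- correspond bijectively.
  refine Finset.sum_bij_ne_zero
    (fun x _ _ => ((x.1 + d : ℤ).toNat, (x.2.1 + e : ℤ).toNat, (x.2.2 + f : ℤ).toNat))
    (fun x hx hw => ?_) (fun x hx hw y hy hw' h => ?_) (fun y hy hw => ?_) (fun x hx hw => ?_)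
  · have := nonneg hw
    rw [mem_exponents] at hx ⊢
    dsimp only
    omega
  · have := nonneg hw
    have := nonneg hw'
    simp only [Prod.mk.injEq] at h
    refine Prod.ext ?_ (Prod.ext ?_ ?_) <;> omega
  · have hn : 0 ≤ (y.1 : ℤ) - d ∧ 0 ≤ (y.2.1 : ℤ) - e ∧ 0 ≤ (y.2.2 : ℤ) - f := by
      by_contra hn
      refine hw ?_
      have := h2 (y.1 - d) (y.2.1 - e) (y.2.2 - f) (by omega)
      simpa only [sub_add_cancel] using this
    rw [mem_exponents] at hy
    have e1 : ((((y.1 : ℤ) - d).toNat : ℤ) + d) = y.1 := by omega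
    have e2 : ((((y.2.1 : ℤ) - e).toNat : ℤ) + e) = y.2.1 := by omega
    have e3 : ((((y.2.2 : ℤ) - f).toNat : ℤ) + f) = y.2.2 := by omega
    refine ⟨((y.1 - d : ℤ).toNat, (y.2.1 - e : ℤ).toNat, (y.2.2 - f : ℤ).toNat), ?_, ?_, ?_⟩
    · rw [mem_exponents]
      dsimp only
      omega
    · dsimp only
      rwa [e1, e2, e3]
    · dsimp only
      rw [e1, e2, e3]
      simp
  · have := nonneg hw
    dsimp only
    rw [Int.toNat_of_nonneg this.1, Int.toNat_of_nonneg this.2.1, Int.toNat_of_nonneg this.2.2]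

/-- The polynomial `∑ c̃(α, β, γ) X^α Y^β Z^γ` over `α + β + 2γ = t`. -/
def weightPoly (t : ℕ) (X Y Z : ℂ) : ℂ :=
  ∑ x ∈ exponents t, ((cTilde x.1 x.2.1 x.2.2 : ℚ) : ℂ) * X ^ x.1 * Y ^ x.2.1 * Z ^ x.2.2

lemma cTilde_rec {α β γ : ℕ} (h : 0 < α + β + 2 * γ) :
    cTilde α β γ = (2 * (α : ℚ) + 4 * β + 8 * γ - 1) / 24 * cTilde (α - 1) β γ
      + (24 * (γ : ℚ) - 8 * β + 7) / 24 * cTilde α (β - 1) γ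
      - ((α : ℚ) + 1) / 12 * cTilde (α + 1) β (γ - 1)
      + ((β : ℚ) + 1) / 6 * cTilde α (β + 1) (γ - 1)
      - 4 * ((γ : ℚ) + 1) / 3 * cTilde α (β - 3) (γ + 1) := by
  rw [cTilde, if_neg (by omega), if_neg (by omega)]
  simp only [Int.cast_natCast]

/-- The recursion sorted by source: each monomial is sent to $(X-Y)/24$ times itself plus its image
under the derivation given by the rules for $DE_2,DG_2,DE_4$. -/
lemma weightPoly_succ (t : ℕ) (X Y Z : ℂ) :
    weightPoly (t + 1) X Y Z = ∑ x ∈ exponents t, ((cTilde x.1 x.2.1 x.2.2 : ℚ) : ℂ) *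
      ((2 * x.1 + 4 * x.2.1 + 8 * x.2.2 + 1) / 24 * (X ^ (x.1 + 1) * Y ^ x.2.1 * Z ^ x.2.2)
      + (24 * x.2.2 - 8 * x.2.1 - 1) / 24 * (X ^ x.1 * Y ^ (x.2.1 + 1) * Z ^ x.2.2)
      - x.1 / 12 * (X ^ (x.1 - 1) * Y ^ x.2.1 * Z ^ (x.2.2 + 1))
      + x.2.1 / 6 * (X ^ x.1 * Y ^ (x.2.1 - 1) * Z ^ (x.2.2 + 1))
      - 4 * x.2.2 / 3 * (X ^ x.1 * Y ^ (x.2.1 + 3) * Z ^ (x.2.2 - 1))) := by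
  let M : ℤ → ℤ → ℤ → ℂ := fun α β γ => X ^ α.toNat * Y ^ β.toNat * Z ^ γ.toNat
  let w1 : ℤ → ℤ → ℤ → ℂ := fun α β γ =>
    (2 * (α : ℂ) + 4 * β + 8 * γ - 1) / 24 * (cTilde (α - 1) β γ : ℚ) * M α β γ
  let w2 : ℤ → ℤ → ℤ → ℂ := fun α β γ =>
    (24 * (γ : ℂ) - 8 * β + 7) / 24 * (cTilde α (β - 1) γ : ℚ) * M α β γ
  let w3 : ℤ → ℤ → ℤ → ℂ := fun α β γ =>
    -(((α : ℂ) + 1) / 12) * (cTilde (α + 1) β (γ - 1) : ℚ) * M α β γ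
  let w4 : ℤ → ℤ → ℤ → ℂ := fun α β γ =>
    ((β : ℂ) + 1) / 6 * (cTilde α (β + 1) (γ - 1) : ℚ) * M α β γ
  let w5 : ℤ → ℤ → ℤ → ℂ := fun α β γ =>
    -(4 * ((γ : ℂ) + 1) / 3) * (cTilde α (β - 3) (γ + 1) : ℚ) * M α β γ
  have s1 := sum_exponents_shift (t := t) (w := w1) (d := 1) (e := 0) (f := 0) (by norm_num)
    (fun α β γ h => by simp only [w1]; rw [cTilde_eq_zero (by omega)]; simp)
    (fun α β γ h => by simp only [w1]; rw [cTilde_eq_zero (by omega)]; simp)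
  have s2 := sum_exponents_shift (t := t) (w := w2) (d := 0) (e := 1) (f := 0) (by norm_num)
    (fun α β γ h => by simp only [w2]; rw [cTilde_eq_zero (by omega)]; simp)
    (fun α β γ h => by simp only [w2]; rw [cTilde_eq_zero (by omega)]; simp)
  have s3 := sum_exponents_shift (t := t) (w := w3) (d := -1) (e := 0) (f := 1) (by norm_num)
    (fun α β γ h => by
      simp only [w3]
      -- At $\alpha=-1$ the coefficient `cTilde` has first index $0$ and need not vanish, but the
      -- factor $\alpha+1$ does. The same happens for $\beta$ and $\gamma$ below.
      rcases eq_or_ne α (-1) with rfl | h1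
      · simp
      · rw [cTilde_eq_zero (by omega)]; simp)
    (fun α β γ h => by simp only [w3]; rw [cTilde_eq_zero (by omega)]; simp)
  have s4 := sum_exponents_shift (t := t) (w := w4) (d := 0) (e := -1) (f := 1) (by norm_num)
    (fun α β γ h => by
      simp only [w4]
      rcases eq_or_ne β (-1) with rfl | h1
      · simp
      · rw [cTilde_eq_zero (by omega)]; simp)
    (fun α β γ h => by simp only [w4]; rw [cTilde_eq_zero (by omega)]; simp)
  have s5 := sum_exponents_shift (t := t) (w := w5) (d := 0) (e := 3) (f := -1) (by norm_num)
    (fun α β γ h => by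
      simp only [w5]
      rcases eq_or_ne γ (-1) with rfl | h1
      · simp
      · rw [cTilde_eq_zero (by omega)]; simp)
    (fun α β γ h => by simp only [w5]; rw [cTilde_eq_zero (by omega)]; simp)
  have hL : weightPoly (t + 1) X Y Z = ∑ x ∈ exponents (t + 1),
      (w1 x.1 x.2.1 x.2.2 + w2 x.1 x.2.1 x.2.2 + w3 x.1 x.2.1 x.2.2 + w4 x.1 x.2.1 x.2.2 +
        w5 x.1 x.2.1 x.2.2) := by
    refine Finset.sum_congr rfl fun x hx => ?_
    rw [mem_exponents] at hx
    rw [cTilde_rec (by omega)]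
    simp only [w1, w2, w3, w4, w5, M, Int.toNat_natCast]
    push_cast
    ring
  rw [hL]
  simp only [Finset.sum_add_distrib]
  rw [← s1, ← s2, ← s3, ← s4, ← s5]
  simp only [← Finset.sum_add_distrib]
  refine Finset.sum_congr rfl fun x _ => ?_
  have p1 : ∀ n : ℕ, ((n : ℤ) + 1).toNat = n + 1 := fun n => by omega
  have p3 : ∀ n : ℕ, ((n : ℤ) + 3).toNat = n + 3 := fun n => by omega
  have m1 : ∀ n : ℕ, ((n : ℤ) + -1).toNat = n - 1 := fun n => by omega
  simp only [w1, w2, w3, w4, w5, M, add_zero, p1, p3, m1, Int.toNat_natCast, add_sub_cancel_right,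
    neg_add_cancel_right]
  push_cast
  ring

lemma weightPoly_zero (X Y Z : ℂ) : weightPoly 0 X Y Z = 1 := by
  have : exponents 0 = {(0, 0, 0)} := by
    ext ⟨a, b, c⟩
    rw [mem_exponents, Finset.mem_singleton, Prod.mk.injEq, Prod.mk.injEq]
    dsimp only
    omega
  rw [weightPoly, this, Finset.sum_singleton]
  simp [cTilde_zero]

lemma hasDerivAt_weightPoly {q : ℂ} (hq : ‖q‖ < 1) (t : ℕ) :
    HasDerivAt (fun z => weightPoly t (Eis 1 z) (G2 z) (Eis 2 z))
      (∑ x ∈ exponents t, ((cTilde x.1 x.2.1 x.2.2 : ℚ) : ℂ) *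
        ((x.1 * Eis 1 q ^ (x.1 - 1) * deriv (Eis 1) q * G2 q ^ x.2.1 +
          Eis 1 q ^ x.1 * (x.2.1 * G2 q ^ (x.2.1 - 1) * deriv G2 q)) * Eis 2 q ^ x.2.2 +
          Eis 1 q ^ x.1 * G2 q ^ x.2.1 * (x.2.2 * Eis 2 q ^ (x.2.2 - 1) * deriv (Eis 2) q))) q := by
  have h1 := (differentiableAt_eis_one hq).hasDerivAt
  have h2 := (hasDerivAt_G2 hq).differentiableAt.hasDerivAt
  have h3 := (differentiableAt_eis_two hq).hasDerivAt
  refine HasDerivAt.fun_sum fun x _ => ?_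
  have h := (((h1.pow x.1).mul (h2.pow x.2.1)).mul (h3.pow x.2.2)).const_mul
    ((cTilde x.1 x.2.1 x.2.2 : ℚ) : ℂ)
  refine h.congr_of_eventuallyEq (Eventually.of_forall fun z => ?_)
  simp only [Pi.mul_apply, Pi.pow_apply]
  ring

lemma natCast_mul_pow_pred_mul (n : ℕ) (X : ℂ) : (n : ℂ) * X ^ (n - 1) * X = n * X ^ n := by
  rcases n with _ | n
  · simp
  · rw [Nat.add_sub_cancel, mul_assoc, ← pow_succ]

lemma D_iterate_theta4 (t : ℕ) {q : ℂ} (hq : ‖q‖ < 1) :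
    (D^[t] theta4) q = theta4 q * weightPoly t (Eis 1 q) (G2 q) (Eis 2 q) := by
  induction t generalizing q with
  | zero => simp [weightPoly_zero]
  | succ t ih =>
    have h := deriv_unique (f := D^[t] theta4) hq (fun z hz => ih hz)
      (((differentiableAt_theta4 hq).hasDerivAt.mul (hasDerivAt_weightPoly hq t)
        |>.congr_of_eventuallyEq ((eventually_norm_lt_one hq).mono
          fun z hz => ih hz)).differentiableAt.hasDerivAt)
      ((differentiableAt_theta4 hq).hasDerivAt.mul (hasDerivAt_weightPoly hq t))
    have e0 := D_theta4 hq
    have e1 := D_eis_one hq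
    have e2 := D_G2 hq
    have e3 := D_eis_two hq
    simp only [D] at e0 e1 e2 e3
    rw [Function.iterate_succ_apply', D, h, weightPoly_succ, mul_add, ← mul_assoc, e0,
      mul_left_comm, mul_assoc, ← mul_add, weightPoly, Finset.mul_sum, Finset.mul_sum,
      ← Finset.sum_add_distrib]
    congr 1
    refine Finset.sum_congr rfl fun x _ => ?_
    -- Some terms of the derivation rules contain the differentiated variable itself, so $nX^{n-1}X$
    -- must be contracted to $nX^n$; the factor $n$ covers the truncated exponent at $n=0$.
    have k1 := natCast_mul_pow_pred_mul x.1 (Eis 1 q)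
    have k2 := natCast_mul_pow_pred_mul x.2.1 (G2 q)
    have k3 := natCast_mul_pow_pred_mul x.2.2 (Eis 2 q)
    generalize Eis 1 q ^ (x.1 - 1) = u1 at *
    generalize G2 q ^ (x.2.1 - 1) = u2 at *
    generalize Eis 2 q ^ (x.2.2 - 1) = u3 at *
    rw [pow_succ, pow_succ, pow_succ (Eis 2 q), pow_add (G2 q) _ 3]
    generalize Eis 1 q ^ x.1 = v1 at *
    generalize G2 q ^ x.2.1 = v2 at *
    generalize Eis 2 q ^ x.2.2 = v3 at *
    generalize ((cTilde x.1 x.2.1 x.2.2 : ℚ) : ℂ) = c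
    linear_combination c * x.1 * u1 * v2 * v3 * e1 + c * v1 * x.2.1 * u2 * v3 * e2 +
      c * v1 * v2 * x.2.2 * u3 * e3 + c * v2 * v3 * Eis 1 q / 12 * k1 +
      c * v1 * v3 * (Eis 1 q / 6 - G2 q / 3) * k2 + c * v1 * v2 * (Eis 1 q / 3 + G2 q) * k3

end

end QuasiTheta

theorem theorem5p1 (t : ℕ) (ht : 0 < t) (q : ℂ) (hq : ‖q‖ < 1) :
    QuasiTheta.G2 q = QuasiTheta.Theta 0 1 q ∧
    QuasiTheta.theta4 q ≠ 0 ∧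
    (QuasiTheta.D^[t] QuasiTheta.theta4) q / QuasiTheta.theta4 q =
      ∑ x ∈ (Finset.range (t + 1) ×ˢ Finset.range (t + 1) ×ˢ Finset.range (t + 1)).filter
          (fun x : ℕ × ℕ × ℕ => x.1 + x.2.1 + 2 * x.2.2 = t),
        ((QuasiTheta.cTilde x.1 x.2.1 x.2.2 : ℚ) : ℂ) *
          QuasiTheta.Eis 1 q ^ x.1 * QuasiTheta.G2 q ^ x.2.1 * QuasiTheta.Eis 2 q ^ x.2.2 := by
  refine ⟨QuasiTheta.G2_eq_Theta hq, QuasiTheta.theta4_ne_zero hq, ?_⟩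
  rw [QuasiTheta.D_iterate_theta4 t hq, mul_div_cancel_left₀ _ (QuasiTheta.theta4_ne_zero hq)]
  rfl
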